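/- Let $\mathbb{D}$ be the open unit disk, $\mathbb{T}$ the unit circle, and let $$P_z(\zeta)=\frac{(1-|z_1|^2)(1-|z_2|^2)}{|\zeta_1-z_1|^2|\zeta_2-z_2|^2},\qquad z\in\mathbb{D}^2,\ \zeta\in\mathbb{T}^2,$$ be the Poisson kernel of the bidisk. Let $\mathcal{P}_2$ be the set of holomorphic $f:\mathbb{D}^2\to\mathbb{C}$ with $\Re f>0$ and $f(0,0)=1$, and let $M(\mathcal{P}_2)$ be the convex set of Borel probability measures $\mu$ on $\mathbb{T}^2$ for which there is $f\in\mathcal{P}_2$ with $\Re f(z)=\int_{\mathbb{T}^2}P_z\,d\mu$ for all $z\in\mathbb{D}^2$. Let $n\ge 0$ be an integer and let $\phi=\tilde p/p$ be a rational inner function of degree $(n,1)$; that is, $p\in\mathbb{C}[z_1,z_2]$ has degree at most $n$ in $z_1$ and at most $1$ in $z_2$, $p$ has no zeros in $\mathbb{D}^2$, $\tilde p(z)=z_1^n z_2\,\overline{p(1/\bar z_1,1/\bar z_2)}$, and $p,\tilde p$ have no common factor. Assume $\tilde p(0,0)=0$ and let $\alpha\in\mathbb{T}$. There is a unique finite positive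 Borel measure $\sigma_\alpha$ on $\mathbb{T}^2$ (the Clark measure) with $$\Re\left(\frac{\alpha+\phi(z)}{\alpha-\phi(z)}\right)=\int_{\mathbb{T}^2}P_z\,d\sigma_\alpha\qquad\text{for all } z\in\mathbb{D}^2 .$$ Call $\alpha$ exceptional for $\phi$ if there is $\tau\in\mathbb{T}^2$ with $p(\tau)=0$ such that $\phi$ has non-tangential value $\alpha$ at $\tau$ (that is, for every $c>0$, $\phi(z)\to\alpha$ as $z\to\tau$ within $\{z\in\mathbb{D}^2:\max_j|z_j-\tau_j|\le c\,(1-\max_j|z_j|)\}$), and generic otherwise. Call $p$ $\mathbb{T}^2$-saturated if all common zeros of $p$ and $\tilde p$ in $\mathbb{C}_\infty\times\mathbb{C}_\infty$ (each polynomial being bihomogenized in its own bidegree) lie on $\mathbb{T}^2$. Write $\deg q=(\deg_{z_1}q,\deg_{z_2}q)$. Then: (i) If $\alpha$ is exceptional for $\phi$, then $\sigma_\alpha$ is not an extreme point of $M(\mathcal{P}_2)$. (ii) If $p$ is $\mathbb{T}^2$-saturated, $\deg p=\deg\tilde p$, and $\alpha$ is generic for $\phi$, then $\sigma_\alpha$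 is an extreme point of $M(\mathcal{P}_2)$. -/

import Mathlib

open scoped NNReal Topology ComplexConjugate

noncomputable section

/-- The circle carries its Borel σ-algebra (and `Circle × Circle` the product, which is the Borel
σ-algebra of the torus). -/
instance instMeasurableSpaceCircle : MeasurableSpace Circle := borel Circle

instance instBorelSpaceCircle : BorelSpace Circle := ⟨rfl⟩

/-- The open unit bidisk `𝔻²`. -/
def bidisk : Set (ℂ × ℂ) := Metric.ball (0 : ℂ) 1 ×ˢ Metric.ball (0 : ℂ) 1

/-- A point of the torus `𝕋² = Circle × Circle`, seen in `ℂ²`. -/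
def torusPt (ζ : Circle × Circle) : ℂ × ℂ := ((ζ.1 : ℂ), (ζ.2 : ℂ))

/-- The value at `z ∈ ℂ²` of a polynomial in two variables (`X 0` is `z₁`, `X 1` is `z₂`). -/
def evalAt (p : MvPolynomial (Fin 2) ℂ) (z : ℂ × ℂ) : ℂ :=
  MvPolynomial.eval ![z.1, z.2] p

/-- `deg p = (deg₁ p, deg₂ p)`. -/
def bidegree (p : MvPolynomial (Fin 2) ℂ) : ℕ × ℕ :=
  (p.degreeOf 0, p.degreeOf 1)

/-- The `(m₁, m₂)`-reflection `z₁^{m₁} z₂^{m₂} conj (p (1 / conj z₁, 1 / conj z₂))`, written out on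
coefficients; meaningful for `(m₁, m₂) ≥ deg p`. -/
def reflection (m₁ m₂ : ℕ) (p : MvPolynomial (Fin 2) ℂ) : MvPolynomial (Fin 2) ℂ :=
  ∑ s ∈ p.support,
    MvPolynomial.C (conj (p.coeff s)) *
      MvPolynomial.X 0 ^ (m₁ - s 0) * MvPolynomial.X 1 ^ (m₂ - s 1)

/-- On its domain, the reflection is given by the usual formula. -/
theorem evalAt_reflection (m₁ m₂ : ℕ) (p : MvPolynomial (Fin 2) ℂ)
    (h₁ : p.degreeOf 0 ≤ m₁) (h₂ : p.degreeOf 1 ≤ m₂) (z : ℂ × ℂ) (hz₁ : z.1 ≠ 0) (hz₂ : z.2 ≠ 0) :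
    evalAt (reflection m₁ m₂ p) z =
      z.1 ^ m₁ * z.2 ^ m₂ * conj (evalAt p (1 / conj z.1, 1 / conj z.2)) := by
  unfold evalAt reflection
  rw [MvPolynomial.eval_eq' _ p, map_sum, map_sum, Finset.mul_sum]
  refine Finset.sum_congr rfl fun s hs => ?_
  have e₁ : s 0 ≤ m₁ := (MvPolynomial.degreeOf_le_iff.1 h₁) s hs
  have e₂ : s 1 ≤ m₂ := (MvPolynomial.degreeOf_le_iff.1 h₂) s hs
  simp only [map_mul, map_pow, MvPolynomial.eval_C, MvPolynomial.eval_X, Fin.prod_univ_two,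
    Matrix.cons_val_zero, Matrix.cons_val_one, map_div₀, map_one, Complex.conj_conj]
  rw [pow_sub₀ _ hz₁ e₁, pow_sub₀ _ hz₂ e₂]
  simp only [one_div, inv_pow]
  ring

/-- `p` is the denominator of a rational inner function `φ = p̃ / p` of degree `(m₁, m₂)`: `p` has
no zeros on `𝔻²` and shares no common factor with its `(m₁, m₂)`-reflection `p̃`. As `p (0, 0) ≠ 0`,
the degree of `p̃`, which is by definition the degree of `φ`, is then exactly `(m₁, m₂)`. -/
structure IsRIFDenominator (m₁ m₂ : ℕ) (p : MvPolynomial (Fin 2) ℂ) : Prop where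
  degree_fst : p.degreeOf 0 ≤ m₁
  degree_snd : p.degreeOf 1 ≤ m₂
  ne_zero : ∀ z ∈ bidisk, evalAt p z ≠ 0
  relPrime : IsRelPrime (reflection m₁ m₂ p) p

/-- The rational inner function `φ = p̃ / p`. -/
def rif (m₁ m₂ : ℕ) (p : MvPolynomial (Fin 2) ℂ) (z : ℂ × ℂ) : ℂ :=
  evalAt (reflection m₁ m₂ p) z / evalAt p z

/-- `f` has non-tangential value `a` at `τ ∈ 𝕋²`: `f z → a` as `z → τ` inside each region
`‖z - τ‖ ≤ c (1 - ‖z‖)` of `𝔻²`, with the maximum norm of `ℂ²`. -/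
def HasNontangentialValue (f : ℂ × ℂ → ℂ) (τ : Circle × Circle) (a : ℂ) : Prop :=
  ∀ c : ℝ, 0 < c →
    Filter.Tendsto f
      (𝓝[{z | z ∈ bidisk ∧ ‖z - torusPt τ‖ ≤ c * (1 - ‖z‖)}] (torusPt τ)) (𝓝 a)

/-- `α` is an exceptional value of `φ = p̃ / p`: it is the non-tangential value of `φ` at some zero
of `p` on `𝕋²`. -/
def IsExceptionalValue (m₁ m₂ : ℕ) (p : MvPolynomial (Fin 2) ℂ) (α : Circle) : Prop :=
  ∃ τ : Circle × Circle, evalAt p (torusPt τ) = 0 ∧ HasNontangentialValue (rif m₁ m₂ p) τ α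

/-- `α` is a generic value of `φ = p̃ / p` if it is not exceptional. -/
def IsGenericValue (m₁ m₂ : ℕ) (p : MvPolynomial (Fin 2) ℂ) (α : Circle) : Prop :=
  ¬ IsExceptionalValue m₁ m₂ p α

/-- The bihomogenization of `p` in its own bidegree, at homogeneous coordinates `x = (x₀ : x₁)`,
`y = (y₀ : y₁)` of a point of `ℂ_∞ × ℂ_∞`; the finite points are `z₁ = x₀ / x₁`, `z₂ = y₀ / y₁`. -/
def bihomEval (p : MvPolynomial (Fin 2) ℂ) (x y : ℂ × ℂ) : ℂ :=
  ∑ s ∈ p.support,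
    p.coeff s * (x.1 ^ s 0 * x.2 ^ (p.degreeOf 0 - s 0)) *
      (y.1 ^ s 1 * y.2 ^ (p.degreeOf 1 - s 1))

/-- `p` is `𝕋²`-saturated with respect to its `(m₁, m₂)`-reflection `p̃`: all common zeros of `p`
and `p̃` in `ℂ_∞ × ℂ_∞` lie on `𝕋²`. -/
def IsTorusSaturated (m₁ m₂ : ℕ) (p : MvPolynomial (Fin 2) ℂ) : Prop :=
  ∀ x y : ℂ × ℂ, x ≠ 0 → y ≠ 0 →
    bihomEval p x y = 0 → bihomEval (reflection m₁ m₂ p) x y = 0 →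
      ‖x.1‖ = ‖x.2‖ ∧ ‖y.1‖ = ‖y.2‖

/-- The Poisson kernel of the bidisk. -/
def poissonKernel₂ (z : ℂ × ℂ) (ζ : Circle × Circle) : ℝ :=
  ((1 - ‖z.1‖ ^ 2) * (1 - ‖z.2‖ ^ 2)) / (‖(ζ.1 : ℂ) - z.1‖ ^ 2 * ‖(ζ.2 : ℂ) - z.2‖ ^ 2)

/-- `σ` is the Clark measure of `φ` at `α`. -/
def IsClarkMeasure (φ : ℂ × ℂ → ℂ) (α : Circle)
    (σ : MeasureTheory.Measure (Circle × Circle)) : Prop :=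
  MeasureTheory.IsFiniteMeasure σ ∧
    ∀ z ∈ bidisk, (((α : ℂ) + φ z) / ((α : ℂ) - φ z)).re = ∫ ζ, poissonKernel₂ z ζ ∂σ

/-- The class `𝒫₂` of holomorphic functions on `𝔻²` with positive real part and value `1` at the
origin. -/
def caratheodoryClass₂ : Set (ℂ × ℂ → ℂ) :=
  {f | DifferentiableOn ℂ f bidisk ∧ (∀ z ∈ bidisk, 0 < (f z).re) ∧ f (0, 0) = 1}

/-- The set `M(𝒫₂)` of Borel probability measures on `𝕋²` whose Poisson integral is the real part of
a function in `𝒫₂`. -/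
def pluriharmonicMeasures : Set (MeasureTheory.Measure (Circle × Circle)) :=
  {μ | MeasureTheory.IsProbabilityMeasure μ ∧
    ∃ f ∈ caratheodoryClass₂, ∀ z ∈ bidisk, (f z).re = ∫ ζ, poissonKernel₂ z ζ ∂μ}

end

/-! Write p = P + z₂ Q with P, Q polynomials in z₁, and f~ for `conjReverse n f`. Then p̃ = Q~ + z₂
P~ and α p - p̃ = A + z₂ B with A = α P - Q~ (`clarkPoly`), B = α Q - P~ (`clarkPolySnd`). On the
circle B = -α z₁^n conj A, so a zero of A there makes α p - p̃ vanish on a whole line z₁ = τ₁. The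
value α is exceptional exactly when such a zero exists
(`clarkPoly_eq_zero_of_hasNontangentialValue`, `exists_zero_of_clarkPoly`, `hasNontangentialValue`).
The measures considered have Poisson integrals that are real parts of holomorphic functions, so
their moments against ζ₁^j ζ₂^(-k) with j, k > 0 vanish (`integral_torusChar_mixed_eq_zero`). Both
parts rest on this. (i) If A(τ₁) = 0, Schwarz's lemma shows that σ charges the line z₁ = τ₁
(`torusLine_mass_pos`). Vanishing mixed moments force σ to be uniform on that line
(`restrict_torusLine`), and the uniform measure is itself admissible. An extreme σ would equal it,
so φ would be a rotation of z₁ and p a unit, contradicting the zero of p on the torus. (ii) If A has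
no zero on the circle, σ lives on the graph of the continuous function -A/B, over a marginal with
density w / |A|², w = |P|² - |Q|² (`isClarkMeasure_graph`). Let μ be admissible with μ ≤ C σ, and
let λ be its first marginal. On the graph |A|² ζ₁^l = α⁻¹ A² ζ₁^(l-n) ζ₂⁻¹, so the moments of |A|² λ
beyond order n vanish; its density v is a trigonometric polynomial of degree at most n with 0 ≤ v ≤
C w. Saturation says that ζ^n w is a polynomial of degree 2 n with all zeros on the circle
(`IsTorusSaturated.resultant`), so v / w is constant (`exists_eq_smul_withDensity`) and μ = σ
(`eq_of_le_smul`). -/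

open MeasureTheory Metric Set Filter

noncomputable section

/-! ### The uniform measure on the circle and the Poisson kernel -/

/-- The rotation-invariant probability measure on the circle. -/
def circleMeasure : Measure Circle :=
  (ENNReal.ofReal (2 * Real.pi)⁻¹ • (volume.restrict (Ioc 0 (2 * Real.pi)))).map Circle.exp

instance isProbabilityMeasure_circleMeasure : IsProbabilityMeasure circleMeasure := by
  have : IsProbabilityMeasure
      (ENNReal.ofReal (2 * Real.pi)⁻¹ • (volume.restrict (Ioc 0 (2 * Real.pi)))) := by
    constructor
    simp only [Measure.smul_apply, Measure.restrict_apply_univ, Real.volume_Ioc, smul_eq_mul]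
    rw [← ENNReal.ofReal_mul (by positivity), sub_zero, inv_mul_cancel₀ (by positivity),
      ENNReal.ofReal_one]
  exact Measure.isProbabilityMeasure_map Circle.exp.continuous.measurable.aemeasurable

theorem integrable_of_continuous {X E : Type*} [TopologicalSpace X] [CompactSpace X]
    [MeasurableSpace X] [OpensMeasurableSpace X] [NormedAddCommGroup E]
    [SecondCountableTopologyEither X E] {μ : Measure X} [IsFiniteMeasure μ]
    {f : X → E} (hf : Continuous f) : Integrable f μ :=
  hf.integrable_of_hasCompactSupport (HasCompactSupport.of_compactSpace f)

theorem integral_circleMeasure {g : ℂ → ℂ} (hg : Continuous fun ζ : Circle => g ζ) :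
    ∫ ζ : Circle, g ζ ∂circleMeasure = Real.circleAverage g 0 1 := by
  rw [circleMeasure, integral_map Circle.exp.continuous.measurable.aemeasurable
    hg.aestronglyMeasurable, integral_smul_measure, Real.circleAverage_def,
    intervalIntegral.integral_of_le (by positivity),
    ENNReal.toReal_ofReal (by positivity)]
  simp [circleMap]

instance isOpenPosMeasure_circleMeasure : circleMeasure.IsOpenPosMeasure := by
  constructor
  rintro U hU ⟨z, hz⟩ h
  rw [circleMeasure, Measure.map_apply Circle.exp.continuous.measurable hU.measurableSet,
    Measure.smul_apply, smul_eq_mul, mul_eq_zero] at h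
  have h2 := h.resolve_left (by simp [Real.pi_pos])
  have hV : IsOpen (Circle.exp ⁻¹' U) := hU.preimage Circle.exp.continuous
  obtain ⟨t, ht, htz⟩ : ∃ t ∈ Ico 0 (2 * Real.pi), Circle.exp t = z := by
    obtain ⟨x, hx⟩ := Circle.exp_surjective z
    obtain ⟨y, hy, hxy⟩ := Circle.periodic_exp.exists_mem_Ico₀ Real.two_pi_pos x
    exact ⟨y, hy, hxy ▸ hx⟩
  -- The parameter t may be the endpoint 0, which carries no interior; the closure supplies points
  -- of the open interval nearby.
  have hcl : t ∈ closure (Ioo 0 (2 * Real.pi)) := by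
    rw [closure_Ioo Real.two_pi_pos.ne]; exact Ico_subset_Icc_self ht
  obtain ⟨s, hs⟩ := mem_closure_iff.1 hcl _ hV (by simpa [htz] using hz)
  have hpos := (hV.inter isOpen_Ioo).measure_pos volume ⟨s, hs⟩
  rw [Measure.restrict_apply hV.measurableSet] at h2
  exact hpos.ne' (measure_mono_null (inter_subset_inter_right _ Ioo_subset_Ioc_self) h2)

/-- The Poisson kernel of the unit disk. -/
def diskPoisson (z : ℂ) (ζ : Circle) : ℝ := (1 - ‖z‖ ^ 2) / ‖(ζ : ℂ) - z‖ ^ 2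

theorem poissonKernel₂_eq_mul (z : ℂ × ℂ) (ζ : Circle × Circle) :
    poissonKernel₂ z ζ = diskPoisson z.1 ζ.1 * diskPoisson z.2 ζ.2 := by
  rw [poissonKernel₂, diskPoisson, diskPoisson, div_mul_div_comm]

theorem circle_sub_ne_zero {z : ℂ} (hz : ‖z‖ < 1) (ζ : Circle) : (ζ : ℂ) - z ≠ 0 := by
  intro h
  have := Circle.norm_coe ζ
  rw [sub_eq_zero.1 h] at this
  linarith

theorem diskPoisson_pos {z : ℂ} (hz : ‖z‖ < 1) (ζ : Circle) : 0 < diskPoisson z ζ := by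
  have := norm_pos_iff.2 (circle_sub_ne_zero hz ζ)
  have := norm_nonneg z
  exact div_pos (by nlinarith) (by positivity)

theorem continuous_diskPoisson {z : ℂ} (hz : ‖z‖ < 1) : Continuous (diskPoisson z) := by
  unfold diskPoisson
  refine Continuous.div (by fun_prop) (by fun_prop) fun ζ => ?_
  have := norm_pos_iff.2 (circle_sub_ne_zero hz ζ)
  positivity

@[simp] theorem diskPoisson_zero (ζ : Circle) : diskPoisson 0 ζ = 1 := by
  simp [diskPoisson, Circle.norm_coe]

theorem re_herglotz_div {a b : ℂ} : ((a + b) / (a - b)).re = (‖a‖ ^ 2 - ‖b‖ ^ 2) / ‖a - b‖ ^ 2 := by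
  have := congrFun (@poissonKernel_eq_re_herglotzRieszKernel 0 b) a
  simpa [poissonKernel, herglotzRieszKernel] using this.symm

theorem diskPoisson_eq_re (z : ℂ) (ζ : Circle) :
    diskPoisson z ζ = (((ζ : ℂ) + z) / (ζ - z)).re := by
  simp [re_herglotz_div, diskPoisson, Circle.norm_coe]

theorem norm_ofReal_mul_circle (r : ℝ) (ζ : Circle) : ‖(r : ℂ) * ζ‖ = |r| := by
  simp [Circle.norm_coe]

/-- The identity |η - r ζ| = |ζ - r η| on the circle. It lets the kernel be integrated in its pole
variable with the usual Poisson formula. -/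
theorem diskPoisson_symm (r : ℝ) (ζ η : Circle) :
    diskPoisson (r * ζ) η = diskPoisson (r * η) ζ := by
  unfold diskPoisson
  have h : ‖(η : ℂ) - r * ζ‖ ^ 2 = ‖(ζ : ℂ) - r * η‖ ^ 2 := by
    have h1 := Circle.normSq_coe ζ
    have h2 := Circle.normSq_coe η
    simp only [← Complex.normSq_eq_norm_sq, Complex.normSq_apply] at *
    simp only [Complex.sub_re, Complex.sub_im, Complex.mul_re, Complex.mul_im, Complex.ofReal_re,
      Complex.ofReal_im]
    linear_combination (r ^ 2 - 1) * h1 + (1 - r ^ 2) * h2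
  rw [h, norm_ofReal_mul_circle, norm_ofReal_mul_circle]

/-- Poisson's formula on the disk. -/
theorem integral_diskPoisson_mul {F : ℂ → ℂ} (hF : DiffContOnCl ℂ F (ball 0 1)) {z : ℂ}
    (hz : ‖z‖ < 1) : ∫ ζ : Circle, (diskPoisson z ζ : ℂ) * F ζ ∂circleMeasure = F z := by
  have hz' : z ∈ ball (0 : ℂ) 1 := by simpa using hz
  have hFc : Continuous fun ζ : Circle => F ζ := by
    refine hF.continuousOn.comp_continuous continuous_subtype_val fun ζ => ?_
    rw [closure_ball _ one_ne_zero]; simp [Circle.norm_coe]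
  rw [← hF.circleAverage_poissonKernel_smul hz', ← integral_circleMeasure]
  · refine integral_congr_ae (.of_forall fun ζ => ?_)
    simp [poissonKernel, diskPoisson, Circle.norm_coe]
  · have : (fun ζ : Circle => (poissonKernel 0 z • F) ζ)
        = fun ζ : Circle => (diskPoisson z ζ : ℂ) * F ζ := by
      ext ζ; simp [poissonKernel, diskPoisson, Circle.norm_coe]
    rw [this]
    exact (Complex.continuous_ofReal.comp (continuous_diskPoisson hz)).mul hFc

theorem integral_circle_eq_apply_zero {F : ℂ → ℂ} (hF : DiffContOnCl ℂ F (ball 0 1)) :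
    ∫ ζ : Circle, F ζ ∂circleMeasure = F 0 := by
  simpa using integral_diskPoisson_mul hF (z := 0) (by simp)

theorem integral_diskPoisson {z : ℂ} (hz : ‖z‖ < 1) :
    ∫ ζ : Circle, diskPoisson z ζ ∂circleMeasure = 1 := by
  have := integral_diskPoisson_mul (F := fun _ => 1) diffContOnCl_const hz
  simp only [mul_one, integral_complex_ofReal] at this
  exact_mod_cast this

theorem diffContOnCl_pow (k : ℕ) : DiffContOnCl ℂ (fun z : ℂ => z ^ k) (ball 0 1) :=
  (differentiable_id.pow k).diffContOnCl

theorem integral_diskPoisson_mul_zpow {z : ℂ} (hz : ‖z‖ < 1) (k : ℕ) :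
    ∫ ζ : Circle, (diskPoisson z ζ : ℂ) * ((ζ ^ (-k : ℤ) : Circle) : ℂ) ∂circleMeasure
      = conj (z ^ k) := by
  rw [← integral_diskPoisson_mul (diffContOnCl_pow k) hz, ← integral_conj]
  refine integral_congr_ae (.of_forall fun ζ => ?_)
  simp [← Circle.coe_inv_eq_conj]

/-- Moments of the Poisson kernel as a function of the pole. -/
theorem integral_diskPoisson_mul_character {r : ℝ} (hr : |r| < 1) (η : Circle) (k : ℤ) :
    ∫ ζ : Circle, (diskPoisson (r * ζ) η : ℂ) * ((ζ ^ k : Circle) : ℂ) ∂circleMeasure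
      = r ^ k.natAbs * ((η ^ k : Circle) : ℂ) := by
  simp_rw [fun ζ => diskPoisson_symm r ζ η]
  have hη : ‖(r : ℂ) * η‖ < 1 := by rwa [norm_ofReal_mul_circle]
  obtain ⟨k, rfl | rfl⟩ := k.eq_nat_or_neg
  · have := integral_diskPoisson_mul (diffContOnCl_pow k) hη
    simpa [mul_pow] using this
  · rw [integral_diskPoisson_mul_zpow hη]
    simp [mul_pow, ← Circle.coe_inv_eq_conj]

/-- The characters of the torus. -/
def torusChar (j k : ℤ) (ζ : Circle × Circle) : ℂ := ((ζ.1 ^ j * ζ.2 ^ k : Circle) : ℂ)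

theorem continuous_torusChar (j k : ℤ) : Continuous (torusChar j k) := by
  have h : Continuous fun ζ : Circle × Circle => ζ.1 ^ j * ζ.2 ^ k :=
    (continuous_fst.zpow j).mul (continuous_snd.zpow k)
  exact continuous_subtype_val.comp h

theorem norm_torusChar (j k : ℤ) (ζ : Circle × Circle) : ‖torusChar j k ζ‖ = 1 :=
  Circle.norm_coe _

/-! ### Measures on the torus and their Poisson integrals -/

theorem torusChar_mul (j k j' k' : ℤ) (ζ : Circle × Circle) :
    torusChar j k ζ * torusChar j' k' ζ = torusChar (j + j') (k + k') ζ := by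
  simp only [torusChar, ← Circle.coe_mul, zpow_add]
  congr 1
  exact mul_mul_mul_comm _ _ _ _

theorem conj_torusChar (j k : ℤ) (ζ : Circle × Circle) :
    conj (torusChar j k ζ) = torusChar (-j) (-k) ζ := by
  simp only [torusChar, ← Circle.coe_inv_eq_conj, mul_inv, zpow_neg]

/-- The characters of the torus as bounded continuous functions. -/
def torusCharBCF (i : ℤ × ℤ) : BoundedContinuousFunction (Circle × Circle) ℂ :=
  BoundedContinuousFunction.mkOfCompact ⟨torusChar i.1 i.2, continuous_torusChar _ _⟩

/-- The trigonometric polynomials on the torus. -/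
def trigPolynomials : StarSubalgebra ℂ (BoundedContinuousFunction (Circle × Circle) ℂ) where
  toSubalgebra := (Submodule.span ℂ (range torusCharBCF)).toSubalgebra
    (Submodule.subset_span ⟨(0, 0), by ext ζ; simp [torusCharBCF, torusChar]⟩)
    (fun x y hx hy => by
      have h := Submodule.mul_mem_mul hx hy
      rw [Submodule.span_mul_span] at h
      refine Submodule.span_mono ?_ h
      rintro _ ⟨_, ⟨i, rfl⟩, _, ⟨i', rfl⟩, rfl⟩
      refine ⟨(i.1 + i'.1, i.2 + i'.2), ?_⟩
      ext ζ
      simp [torusCharBCF, torusChar_mul])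
  star_mem' := by
    intro x hx
    change star x ∈ Submodule.span ℂ (range torusCharBCF)
    change x ∈ Submodule.span ℂ (range torusCharBCF) at hx
    induction hx using Submodule.span_induction with
    | mem x hx =>
      obtain ⟨i, rfl⟩ := hx
      refine Submodule.subset_span ⟨(-i.1, -i.2), ?_⟩
      ext ζ
      simp [torusCharBCF, conj_torusChar]
    | zero => simp
    | add x y _ _ hx hy => rw [star_add]; exact add_mem hx hy
    | smul c x _ hx => rw [star_smul]; exact Submodule.smul_mem _ _ hx

/-- A finite measure on the torus is determined by its moments. -/
theorem torus_measure_ext {μ ν : Measure (Circle × Circle)} [IsFiniteMeasure μ]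
    [IsFiniteMeasure ν]
    (h : ∀ j k : ℤ, ∫ ζ, torusChar j k ζ ∂μ = ∫ ζ, torusChar j k ζ ∂ν) : μ = ν := by
  refine ext_of_forall_mem_subalgebra_integral_eq_of_polish (𝕜 := ℂ) (A := trigPolynomials) ?_ ?_
  · intro x y hxy
    have key : ∀ j k : ℤ, torusChar j k x ≠ torusChar j k y → ∃ f ∈ (fun f : C(Circle × Circle, ℂ) =>
        (f : Circle × Circle → ℂ)) '' ((trigPolynomials.map
        (BoundedContinuousFunction.toContinuousMapStarₐ ℂ)) : Set C(Circle × Circle, ℂ)),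
        f x ≠ f y := by
      intro j k hjk
      exact ⟨torusChar j k, ⟨⟨torusChar j k, continuous_torusChar j k⟩,
        ⟨torusCharBCF (j, k), Submodule.subset_span ⟨(j, k), rfl⟩, rfl⟩, rfl⟩, hjk⟩
    by_cases h1 : x.1 = y.1
    · refine key 0 1 fun he => hxy (Prod.ext h1 ?_)
      exact Circle.ext (by simpa [torusChar] using he)
    · refine key 1 0 fun he => h1 ?_
      exact Circle.ext (by simpa [torusChar] using he)
  · intro g hg
    change g ∈ Submodule.span ℂ (range torusCharBCF) at hg
    induction hg using Submodule.span_induction with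
    | mem x hx => obtain ⟨i, rfl⟩ := hx; exact h i.1 i.2
    | zero => simp
    | add x y _ _ hx hy =>
      simp only [BoundedContinuousFunction.coe_add, Pi.add_apply]
      rw [integral_add (x.integrable μ) (y.integrable μ),
        integral_add (x.integrable ν) (y.integrable ν), hx, hy]
    | smul c x _ hx =>
      simp only [BoundedContinuousFunction.coe_smul]
      rw [integral_smul, integral_smul, hx]

/-- A finite measure on the circle is determined by its moments. -/
theorem circle_measure_ext {μ ν : Measure Circle} [IsFiniteMeasure μ] [IsFiniteMeasure ν]
    (h : ∀ j : ℤ, ∫ ζ : Circle, ((ζ ^ j : Circle) : ℂ) ∂μ = ∫ ζ : Circle, ((ζ ^ j : Circle) : ℂ) ∂ν) :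
    μ = ν := by
  -- Embedding the circle as ζ₂ = 1 reduces uniqueness to the torus.
  have hm : Measurable fun ζ : Circle => (ζ, (1 : Circle)) := by fun_prop
  have : μ.map (fun ζ => (ζ, (1 : Circle))) = ν.map (fun ζ => (ζ, (1 : Circle))) := by
    refine torus_measure_ext fun j k => ?_
    rw [integral_map hm.aemeasurable (continuous_torusChar j k).aestronglyMeasurable,
      integral_map hm.aemeasurable (continuous_torusChar j k).aestronglyMeasurable]
    simpa [torusChar] using h j
  have h2 := congrArg (Measure.map Prod.fst) this
  rw [Measure.map_map measurable_fst hm, Measure.map_map measurable_fst hm] at h2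
  simpa [Function.comp_def] using h2

theorem mem_bidisk {z : ℂ × ℂ} : z ∈ bidisk ↔ ‖z.1‖ < 1 ∧ ‖z.2‖ < 1 := by
  simp [bidisk]

theorem isOpen_bidisk : IsOpen bidisk := isOpen_ball.prod isOpen_ball

theorem continuous_poissonKernel₂ {z : ℂ × ℂ} (hz : z ∈ bidisk) :
    Continuous (poissonKernel₂ z) := by
  rw [mem_bidisk] at hz
  rw [show poissonKernel₂ z = fun ζ => diskPoisson z.1 ζ.1 * diskPoisson z.2 ζ.2 from
    funext (poissonKernel₂_eq_mul z)]
  exact ((continuous_diskPoisson hz.1).comp continuous_fst).mul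
    ((continuous_diskPoisson hz.2).comp continuous_snd)

theorem poissonKernel₂_pos {z : ℂ × ℂ} (hz : z ∈ bidisk) (ζ : Circle × Circle) :
    0 < poissonKernel₂ z ζ := by
  rw [mem_bidisk] at hz
  rw [poissonKernel₂_eq_mul]
  exact mul_pos (diskPoisson_pos hz.1 _) (diskPoisson_pos hz.2 _)

/-- The point `r ζ` of the bidisk. -/
def dilate (r : ℝ) (ζ : Circle × Circle) : ℂ × ℂ := ((r : ℂ) * ζ.1, (r : ℂ) * ζ.2)

theorem continuous_dilate (r : ℝ) : Continuous (dilate r) := by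
  unfold dilate
  fun_prop

theorem dilate_mem_bidisk {r : ℝ} (hr : |r| < 1) (ζ : Circle × Circle) : dilate r ζ ∈ bidisk := by
  rw [mem_bidisk]
  simp only [dilate, norm_ofReal_mul_circle]
  exact ⟨hr, hr⟩

theorem continuous_diskPoisson_dilate {r : ℝ} (hr : |r| < 1) :
    Continuous fun q : Circle × Circle => diskPoisson (r * q.1) q.2 := by
  unfold diskPoisson
  refine Continuous.div (by fun_prop) (by fun_prop) fun q => ?_
  have := norm_pos_iff.2 (circle_sub_ne_zero
    (z := (r : ℂ) * q.1) (by rwa [norm_ofReal_mul_circle]) q.2)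
  positivity

theorem continuous_poissonKernel₂_dilate {r : ℝ} (hr : |r| < 1) :
    Continuous fun q : (Circle × Circle) × (Circle × Circle) =>
      poissonKernel₂ (dilate r q.1) q.2 := by
  simp_rw [poissonKernel₂_eq_mul, dilate]
  exact ((continuous_diskPoisson_dilate hr).comp
    (f := fun q : (Circle × Circle) × (Circle × Circle) => (q.1.1, q.2.1)) (by fun_prop)).mul
    ((continuous_diskPoisson_dilate hr).comp
    (f := fun q : (Circle × Circle) × (Circle × Circle) => (q.1.2, q.2.2)) (by fun_prop))

/-- The moments of the dilates of a Poisson integral. -/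
theorem integral_poisson_mul_torusChar (μ : Measure (Circle × Circle)) [IsFiniteMeasure μ]
    {r : ℝ} (hr : |r| < 1) (j k : ℤ) :
    ∫ ζ, ((∫ η, poissonKernel₂ (dilate r ζ) η ∂μ : ℝ) : ℂ) * torusChar j k ζ
        ∂(circleMeasure.prod circleMeasure)
      = r ^ (j.natAbs + k.natAbs) * ∫ η, torusChar j k η ∂μ := by
  have h1 : ∀ ζ : Circle × Circle,
      ((∫ η, poissonKernel₂ (dilate r ζ) η ∂μ : ℝ) : ℂ) * torusChar j k ζ
        = ∫ η, (poissonKernel₂ (dilate r ζ) η : ℂ) * torusChar j k ζ ∂μ := by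
    intro ζ
    rw [← integral_complex_ofReal, integral_mul_const]
  simp_rw [h1]
  -- After Fubini the integral over the pole splits into two one-variable moments, with factors
  -- r^|j| and r^|k|.
  rw [integral_integral_swap, ← integral_const_mul]
  · refine integral_congr_ae (.of_forall fun η => ?_)
    have h2 : ∀ ζ : Circle × Circle, (poissonKernel₂ (dilate r ζ) η : ℂ) * torusChar j k ζ
        = ((diskPoisson (r * ζ.1) η.1 : ℂ) * ((ζ.1 ^ j : Circle) : ℂ)) *
          ((diskPoisson (r * ζ.2) η.2 : ℂ) * ((ζ.2 ^ k : Circle) : ℂ)) := by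
      intro ζ
      rw [poissonKernel₂_eq_mul]
      simp only [dilate, torusChar, Circle.coe_mul, Complex.ofReal_mul]
      ring
    simp only [h2]
    rw [integral_prod_mul (μ := circleMeasure) (ν := circleMeasure)
      (fun ζ : Circle => (diskPoisson (r * ζ) η.1 : ℂ) * ((ζ ^ j : Circle) : ℂ))
      (fun ζ : Circle => (diskPoisson (r * ζ) η.2 : ℂ) * ((ζ ^ k : Circle) : ℂ)),
      integral_diskPoisson_mul_character hr, integral_diskPoisson_mul_character hr]
    simp only [torusChar, Circle.coe_mul, pow_add]
    ring
  · refine integrable_of_continuous ?_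
    exact (Complex.continuous_ofReal.comp (continuous_poissonKernel₂_dilate hr)).mul
      ((continuous_torusChar j k).comp continuous_fst)

/-- A finite measure on the torus is determined by its Poisson integral. -/
theorem measure_eq_of_poisson_eq {μ ν : Measure (Circle × Circle)} [IsFiniteMeasure μ]
    [IsFiniteMeasure ν]
    (h : ∀ z ∈ bidisk, ∫ ζ, poissonKernel₂ z ζ ∂μ = ∫ ζ, poissonKernel₂ z ζ ∂ν) : μ = ν := by
  refine torus_measure_ext fun j k => ?_
  -- Any fixed radius in (0, 1) would do: each moment is only multiplied by a nonzero power of it.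
  have hr : |(1 / 2 : ℝ)| < 1 := by norm_num [abs_lt]
  have h1 := integral_poisson_mul_torusChar μ hr j k
  have h2 := integral_poisson_mul_torusChar ν hr j k
  have h3 : ∀ ζ, ∫ η, poissonKernel₂ (dilate (1 / 2) ζ) η ∂μ
      = ∫ η, poissonKernel₂ (dilate (1 / 2) ζ) η ∂ν := fun ζ => h _ (dilate_mem_bidisk hr ζ)
  simp only [h3] at h1
  rw [h1] at h2
  exact mul_left_cancel₀ (by simp) h2

/-! ### Holomorphic functions on the bidisk: slices, vanishing moments, Poisson formula. -/

theorem diffContOnCl_slice_fst {F : ℂ × ℂ → ℂ} (hF : DifferentiableOn ℂ F bidisk) {r : ℝ}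
    (hr : |r| < 1) {c : ℂ} (hc : ‖c‖ < 1) :
    DiffContOnCl ℂ (fun z : ℂ => F (r * z, c)) (ball 0 1) := by
  refine DifferentiableOn.diffContOnCl ?_
  rw [closure_ball _ one_ne_zero]
  refine hF.comp (Differentiable.differentiableOn (by fun_prop)) fun z hz => ?_
  rw [mem_bidisk]
  have hz' : ‖z‖ ≤ 1 := by simpa using hz
  refine ⟨?_, hc⟩
  rw [norm_mul, Complex.norm_real, Real.norm_eq_abs]
  nlinarith [abs_nonneg r, norm_nonneg z]

theorem diffContOnCl_slice_snd {F : ℂ × ℂ → ℂ} (hF : DifferentiableOn ℂ F bidisk) {r : ℝ}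
    (hr : |r| < 1) {c : ℂ} (hc : ‖c‖ < 1) :
    DiffContOnCl ℂ (fun z : ℂ => F (c, r * z)) (ball 0 1) := by
  have hsw : DifferentiableOn ℂ (fun z : ℂ × ℂ => F (z.2, z.1)) bidisk := by
    refine hF.comp (f := fun z : ℂ × ℂ => (z.2, z.1))
      (Differentiable.differentiableOn (by fun_prop)) fun z hz => ?_
    rw [mem_bidisk] at hz ⊢
    exact ⟨hz.2, hz.1⟩
  exact diffContOnCl_slice_fst hsw hr hc

theorem continuous_comp_dilate {F : ℂ × ℂ → ℂ} (hF : DifferentiableOn ℂ F bidisk) {r : ℝ}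
    (hr : |r| < 1) : Continuous fun ζ => F (dilate r ζ) :=
  hF.continuousOn.comp_continuous (continuous_dilate r) (dilate_mem_bidisk hr)

/-- For fixed ζ₂ the integrand is, up to a constant, the boundary value of a holomorphic function of
z₁ with the factor z₁^j, so its mean value is 0. -/
theorem integral_dilate_mul_torusChar_eq_zero_fst {F : ℂ × ℂ → ℂ} (hF : DifferentiableOn ℂ F bidisk)
    {r : ℝ} (hr : |r| < 1) {j : ℕ} (hj : j ≠ 0) (k : ℤ) :
    ∫ ζ, F (dilate r ζ) * torusChar j k ζ ∂(circleMeasure.prod circleMeasure) = 0 := by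
  rw [integral_prod_symm _ (integrable_of_continuous (by
    exact (continuous_comp_dilate hF hr).mul (continuous_torusChar j k)))]
  refine integral_eq_zero_of_ae (.of_forall fun ζ₂ => ?_)
  have h := integral_circle_eq_apply_zero ((diffContOnCl_slice_fst hF hr
    (c := r * ζ₂) (by rwa [norm_ofReal_mul_circle])).smul (diffContOnCl_pow j))
  simp only [smul_eq_mul, zero_pow hj, mul_zero] at h
  have h2 : ∀ ζ₁ : Circle, F (dilate r (ζ₁, ζ₂)) * torusChar j k (ζ₁, ζ₂)
      = F (r * ζ₁, r * ζ₂) * (ζ₁ : ℂ) ^ j * ((ζ₂ ^ k : Circle) : ℂ) := by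
    intro ζ₁
    simp [dilate, torusChar, mul_assoc]
  simp only [h2, integral_mul_const]
  rw [h, zero_mul]
  rfl

theorem integral_dilate_mul_torusChar_eq_zero_snd {F : ℂ × ℂ → ℂ} (hF : DifferentiableOn ℂ F bidisk)
    {r : ℝ} (hr : |r| < 1) (j : ℤ) {k : ℕ} (hk : k ≠ 0) :
    ∫ ζ, F (dilate r ζ) * torusChar j k ζ ∂(circleMeasure.prod circleMeasure) = 0 := by
  rw [integral_prod _ (integrable_of_continuous (by
    exact (continuous_comp_dilate hF hr).mul (continuous_torusChar j k)))]
  refine integral_eq_zero_of_ae (.of_forall fun ζ₁ => ?_)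
  have h := integral_circle_eq_apply_zero ((diffContOnCl_slice_snd hF hr
    (c := r * ζ₁) (by rwa [norm_ofReal_mul_circle])).smul (diffContOnCl_pow k))
  simp only [smul_eq_mul, zero_pow hk, mul_zero] at h
  have h2 : ∀ ζ₂ : Circle, F (dilate r (ζ₁, ζ₂)) * torusChar j k (ζ₁, ζ₂)
      = F (r * ζ₁, r * ζ₂) * (ζ₂ : ℂ) ^ k * ((ζ₁ ^ j : Circle) : ℂ) := by
    intro ζ₂
    simp only [dilate, torusChar, Circle.coe_mul, zpow_natCast, Circle.coe_pow]
    ring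
  simp only [h2, integral_mul_const]
  rw [h, zero_mul]
  rfl

/-- The mixed moments of a measure with pluriharmonic Poisson integral vanish. -/
theorem integral_torusChar_mixed_eq_zero {μ : Measure (Circle × Circle)} [IsFiniteMeasure μ]
    {F : ℂ × ℂ → ℂ} (hF : DifferentiableOn ℂ F bidisk)
    (h : ∀ z ∈ bidisk, (F z).re = ∫ ζ, poissonKernel₂ z ζ ∂μ) {j k : ℕ} (hj : j ≠ 0) (hk : k ≠ 0) :
    ∫ ζ, torusChar j (-k) ζ ∂μ = 0 := by
  have hr : |(1 / 2 : ℝ)| < 1 := by norm_num [abs_lt]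
  have h1 := integral_poisson_mul_torusChar μ hr j (-k)
  -- Split Re F = (F + conj F) / 2. The first half is killed in the first variable by j > 0; the
  -- second, once conjugated, carries the frequencies (-j, k) and is killed in the second variable
  -- by k > 0.
  have h2 : ∀ ζ, ((∫ η, poissonKernel₂ (dilate (1 / 2) ζ) η ∂μ : ℝ) : ℂ) * torusChar j (-k) ζ
      = (1 / 2 : ℂ) * (F (dilate (1 / 2) ζ) * torusChar j (-k) ζ)
        + (1 / 2 : ℂ) * conj (F (dilate (1 / 2) ζ) * torusChar (-j) k ζ) := by
    intro ζ
    rw [← h _ (dilate_mem_bidisk hr ζ), Complex.re_eq_add_conj, map_mul, conj_torusChar, neg_neg]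
    ring
  simp only [h2] at h1
  have hc := continuous_comp_dilate hF hr
  rw [integral_add (integrable_of_continuous (by
      exact continuous_const.mul (hc.mul (continuous_torusChar _ _))))
      (integrable_of_continuous (by
      exact continuous_const.mul (Complex.continuous_conj.comp
        (hc.mul (continuous_torusChar _ _))))), integral_const_mul, integral_const_mul,
    integral_conj, integral_dilate_mul_torusChar_eq_zero_fst hF hr hj,
    integral_dilate_mul_torusChar_eq_zero_snd hF hr _ hk] at h1
  simp only [map_zero, mul_zero, add_zero] at h1
  exact (mul_eq_zero.1 h1.symm).resolve_left (by simp)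

/-- Poisson's formula on the bidisk for dilates. -/
theorem integral_poissonKernel₂_mul_dilate {F : ℂ × ℂ → ℂ} (hF : DifferentiableOn ℂ F bidisk)
    {r : ℝ} (hr : |r| < 1) {z : ℂ × ℂ} (hz : z ∈ bidisk) :
    ∫ ζ, (poissonKernel₂ z ζ : ℂ) * F (dilate r ζ) ∂(circleMeasure.prod circleMeasure)
      = F (r * z.1, r * z.2) := by
  have hz' := mem_bidisk.1 hz
  rw [integral_prod _ (integrable_of_continuous (by
    exact (Complex.continuous_ofReal.comp (continuous_poissonKernel₂ hz)).mul
      (continuous_comp_dilate hF hr)))]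
  have h1 : ∀ ζ₁ : Circle, ∫ ζ₂ : Circle, (poissonKernel₂ z (ζ₁, ζ₂) : ℂ) * F (dilate r (ζ₁, ζ₂))
      ∂circleMeasure = (diskPoisson z.1 ζ₁ : ℂ) * F (r * ζ₁, r * z.2) := by
    intro ζ₁
    rw [← integral_diskPoisson_mul (diffContOnCl_slice_snd hF hr
      (c := r * ζ₁) (by rwa [norm_ofReal_mul_circle])) hz'.2, ← integral_const_mul]
    refine integral_congr_ae (.of_forall fun ζ₂ => ?_)
    simp only [poissonKernel₂_eq_mul, Complex.ofReal_mul, dilate]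
    ring
  simp only [h1]
  refine integral_diskPoisson_mul (diffContOnCl_slice_fst hF hr (c := r * z.2) ?_) hz'.1
  rw [norm_mul, Complex.norm_real, Real.norm_eq_abs]
  nlinarith [abs_nonneg r, norm_nonneg z.2]

theorem integral_poissonKernel₂_mul_re_dilate {F : ℂ × ℂ → ℂ} (hF : DifferentiableOn ℂ F bidisk)
    {r : ℝ} (hr : |r| < 1) {z : ℂ × ℂ} (hz : z ∈ bidisk) :
    ∫ ζ, (F (dilate r ζ)).re * poissonKernel₂ z ζ ∂(circleMeasure.prod circleMeasure)
      = (F (r * z.1, r * z.2)).re := by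
  rw [← integral_poissonKernel₂_mul_dilate hF hr hz]
  have h := integral_re (𝕜 := ℂ) (μ := circleMeasure.prod circleMeasure)
    (f := fun ζ => (poissonKernel₂ z ζ : ℂ) * F (dilate r ζ))
    (integrable_of_continuous ((Complex.continuous_ofReal.comp
      (continuous_poissonKernel₂ hz)).mul (continuous_comp_dilate hF hr)))
  simp only [RCLike.re_eq_complex_re] at h
  rw [← h]
  refine integral_congr_ae (.of_forall fun ζ => ?_)
  simp [mul_comm]

theorem zero_mem_bidisk : ((0, 0) : ℂ × ℂ) ∈ bidisk := by simp [mem_bidisk]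

@[simp] theorem poissonKernel₂_zero (ζ : Circle × Circle) : poissonKernel₂ (0, 0) ζ = 1 := by
  simp [poissonKernel₂_eq_mul]

/-! ### The Herglotz representation on the bidisk. -/

/-- The radial measures of a function with positive real part. -/
def radialMeasure (F : ℂ × ℂ → ℂ) (r : ℝ) : Measure (Circle × Circle) :=
  (circleMeasure.prod circleMeasure).withDensity fun ζ => ENNReal.ofReal (F (dilate r ζ)).re

theorem integral_radialMeasure {F : ℂ × ℂ → ℂ} (hF : DifferentiableOn ℂ F bidisk)
    (hpos : ∀ z ∈ bidisk, 0 < (F z).re) {r : ℝ} (hr : |r| < 1) {z : ℂ × ℂ} (hz : z ∈ bidisk) :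
    ∫ ζ, poissonKernel₂ z ζ ∂(radialMeasure F r) = (F (r * z.1, r * z.2)).re := by
  have hc := continuous_comp_dilate hF hr
  rw [radialMeasure, integral_withDensity_eq_integral_toReal_smul
    (by exact (Complex.continuous_re.comp hc).measurable.ennreal_ofReal) (.of_forall fun _ => by simp),
    ← integral_poissonKernel₂_mul_re_dilate hF hr hz]
  refine integral_congr_ae (.of_forall fun ζ => ?_)
  simp only [smul_eq_mul]
  rw [ENNReal.toReal_ofReal (hpos _ (dilate_mem_bidisk hr ζ)).le]

theorem isProbabilityMeasure_radialMeasure {F : ℂ × ℂ → ℂ} (hF : F ∈ caratheodoryClass₂)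
    {r : ℝ} (hr : |r| < 1) : IsProbabilityMeasure (radialMeasure F r) := by
  obtain ⟨hd, hpos, h0⟩ := hF
  have hfin : IsFiniteMeasure (radialMeasure F r) :=
    isFiniteMeasure_withDensity_ofReal
      (integrable_of_continuous (Complex.continuous_re.comp (continuous_comp_dilate hd hr))).2
  have h := integral_radialMeasure hd hpos hr zero_mem_bidisk
  simp only [poissonKernel₂_zero, mul_zero, h0, Complex.one_re, integral_const, smul_eq_mul,
    mul_one] at h
  exact ⟨by simpa [measureReal_def, ENNReal.toReal_eq_one_iff] using h⟩

/-- Functions of the Carathéodory class are represented by probability measures. -/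
theorem exists_measure_of_caratheodory {F : ℂ × ℂ → ℂ} (hF : F ∈ caratheodoryClass₂) :
    ∃ σ : Measure (Circle × Circle), IsProbabilityMeasure σ ∧
      ∀ z ∈ bidisk, (F z).re = ∫ ζ, poissonKernel₂ z ζ ∂σ := by
  let r : ℕ → ℝ := fun k => 1 - 1 / ((k : ℝ) + 1)
  have hr0 : ∀ k, |r k| < 1 := by
    intro k
    have h1 : 0 < 1 / ((k : ℝ) + 1) := by positivity
    have h2 : 1 / ((k : ℝ) + 1) ≤ 1 := by
      rw [div_le_one (by positivity)]; linarith [(Nat.cast_nonneg k : (0 : ℝ) ≤ k)]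
    rw [abs_lt]
    constructor <;> simp only [r] <;> linarith
  have hrlim : Tendsto r atTop (𝓝 1) := by
    simpa [r] using (tendsto_one_div_add_atTop_nhds_zero_nat (𝕜 := ℝ)).const_sub 1
  let s : ℕ → ProbabilityMeasure (Circle × Circle) := fun k =>
    ⟨radialMeasure F (r k), isProbabilityMeasure_radialMeasure hF (hr0 k)⟩
  -- Probability measures on the compact torus are weakly compact; an ultrafilter limit as r → 1
  -- replaces the extraction of a subsequence.
  let 𝒰 : Ultrafilter (ProbabilityMeasure (Circle × Circle)) := (hyperfilter ℕ).map s
  obtain ⟨σ, -, hσ⟩ := isCompact_univ.ultrafilter_le_nhds 𝒰 (by simp)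
  have hσ' : Tendsto s (hyperfilter ℕ) (𝓝 σ) := hσ
  rw [ProbabilityMeasure.tendsto_iff_forall_integral_tendsto] at hσ'
  refine ⟨σ, inferInstance, fun z hz => ?_⟩
  have h1 := hσ' (BoundedContinuousFunction.mkOfCompact
    ⟨poissonKernel₂ z, continuous_poissonKernel₂ hz⟩)
  simp only [BoundedContinuousFunction.mkOfCompact_apply, ContinuousMap.coe_mk] at h1
  have h2 : ∀ k, ∫ ζ, poissonKernel₂ z ζ ∂(s k : Measure (Circle × Circle))
      = (F (r k * z.1, r k * z.2)).re := fun k =>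
    integral_radialMeasure hF.1 hF.2.1 (hr0 k) hz
  simp only [h2] at h1
  have h3 : Tendsto (fun k => (F (r k * z.1, r k * z.2)).re) atTop (𝓝 (F z).re) := by
    have hc : ContinuousAt F z := (hF.1.differentiableAt (isOpen_bidisk.mem_nhds hz)).continuousAt
    refine (Complex.continuous_re.tendsto _).comp (hc.tendsto.comp ?_)
    have hrc : Tendsto (fun k => (r k : ℂ)) atTop (𝓝 1) := by
      simpa [Function.comp_def] using (Complex.continuous_ofReal.tendsto 1).comp hrlim
    have h4 := (hrc.mul_const z.1).prodMk_nhds (hrc.mul_const z.2)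
    simpa using h4
  exact tendsto_nhds_unique (h3.mono_left Nat.hyperfilter_le_atTop) h1

/-! ### Polynomials of degree at most one in the second variable -/

/-- The exponent `(k, i)`. -/
def biExp (k i : ℕ) : Fin 2 →₀ ℕ := Finsupp.single 0 k + Finsupp.single 1 i

@[simp] theorem biExp_zero (k i : ℕ) : biExp k i 0 = k := by simp [biExp]

@[simp] theorem biExp_one (k i : ℕ) : biExp k i 1 = i := by simp [biExp]

theorem eq_biExp (s : Fin 2 →₀ ℕ) : s = biExp (s 0) (s 1) := by
  ext i; fin_cases i <;> simp

/-- The coefficient of `z₂ ^ i`, as a polynomial of degree at most `n` in `z₁`. -/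
def sndCoeff (n i : ℕ) (p : MvPolynomial (Fin 2) ℂ) : Polynomial ℂ :=
  ∑ k ∈ Finset.range (n + 1), Polynomial.C (p.coeff (biExp k i)) * Polynomial.X ^ k

theorem coeff_sndCoeff {n k : ℕ} (hk : k ≤ n) (i : ℕ) (p : MvPolynomial (Fin 2) ℂ) :
    (sndCoeff n i p).coeff k = p.coeff (biExp k i) := by
  simp only [sndCoeff, Polynomial.finsetSum_coeff, Polynomial.coeff_C_mul_X_pow]
  rw [Finset.sum_ite_eq]
  simp [Nat.lt_succ_iff.2 hk]

theorem natDegree_sndCoeff_le (n i : ℕ) (p : MvPolynomial (Fin 2) ℂ) :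
    (sndCoeff n i p).natDegree ≤ n :=
  Polynomial.natDegree_sum_le_of_forall_le _ _ fun _ hk =>
    (Polynomial.natDegree_C_mul_X_pow_le _ _).trans (Nat.lt_succ_iff.1 (Finset.mem_range.1 hk))

/-- Replacing the support by the fixed box of exponents lets p, its reflection and its
bihomogenization be read off from the same two polynomials in z₁. The box may exceed the support,
whence `hG`. -/
theorem sum_support_eq {M : Type*} [AddCommMonoid M] {n : ℕ} {p : MvPolynomial (Fin 2) ℂ}
    (h₁ : p.degreeOf 0 ≤ n) (h₂ : p.degreeOf 1 ≤ 1) (G : (Fin 2 →₀ ℕ) → M)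
    (hG : ∀ s, p.coeff s = 0 → G s = 0) :
    ∑ s ∈ p.support, G s = ∑ k ∈ Finset.range (n + 1), (G (biExp k 0) + G (biExp k 1)) := by
  have hinj : Set.InjOn (fun x : ℕ × ℕ => biExp x.1 x.2)
      (Finset.range (n + 1) ×ˢ Finset.range 2 : Finset (ℕ × ℕ)) := by
    intro x _ y _ hxy
    have h0 := DFunLike.congr_fun hxy 0
    have h1 := DFunLike.congr_fun hxy 1
    simp only [biExp_zero, biExp_one] at h0 h1
    exact Prod.ext h0 h1
  calc ∑ s ∈ p.support, G s
      = ∑ s ∈ (Finset.range (n + 1) ×ˢ Finset.range 2).image (fun x : ℕ × ℕ => biExp x.1 x.2),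
          G s := by
        refine Finset.sum_subset (fun s hs => ?_) (fun s _ hs => hG s (by simpa using hs))
        have e₁ : s 0 ≤ n := (MvPolynomial.degreeOf_le_iff.1 h₁) s hs
        have e₂ : s 1 ≤ 1 := (MvPolynomial.degreeOf_le_iff.1 h₂) s hs
        refine Finset.mem_image.2 ⟨(s 0, s 1), ?_, (eq_biExp s).symm⟩
        simp only [Finset.mem_product, Finset.mem_range]
        omega
    _ = ∑ x ∈ Finset.range (n + 1) ×ˢ Finset.range 2, G (biExp x.1 x.2) := Finset.sum_image hinj
    _ = _ := by
        rw [Finset.sum_product]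
        simp [Finset.sum_range_succ _ 1]

/-- A polynomial in `z₁`, seen in two variables. -/
def liftFst : Polynomial ℂ →ₐ[ℂ] MvPolynomial (Fin 2) ℂ := Polynomial.aeval (MvPolynomial.X 0)

theorem evalAt_liftFst (f : Polynomial ℂ) (z : ℂ × ℂ) : evalAt (liftFst f) z = f.eval z.1 := by
  unfold evalAt liftFst
  induction f using Polynomial.induction_on' with
  | add f g hf hg => simp [hf, hg]
  | monomial k c => simp [Polynomial.aeval_monomial, MvPolynomial.algebraMap_eq]

theorem eq_liftFst_add {n : ℕ} {p : MvPolynomial (Fin 2) ℂ} (h₁ : p.degreeOf 0 ≤ n)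
    (h₂ : p.degreeOf 1 ≤ 1) :
    p = liftFst (sndCoeff n 0 p) + MvPolynomial.X 1 * liftFst (sndCoeff n 1 p) := by
  conv_lhs => rw [p.as_sum]
  rw [sum_support_eq h₁ h₂ _ (fun s hs => by simp [hs])]
  simp only [liftFst, sndCoeff, map_sum, map_mul, Polynomial.aeval_C, Polynomial.aeval_X, map_pow,
    Finset.sum_add_distrib, Finset.mul_sum, MvPolynomial.algebraMap_eq]
  congr 1 <;> refine Finset.sum_congr rfl fun k _ => ?_
  · simp [MvPolynomial.monomial_eq, Finsupp.prod_fintype]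
  · simp [MvPolynomial.monomial_eq, Finsupp.prod_fintype]; ring

/-! ### Reflection and homogenization. -/

/-- The reflection `z ^ n * conj (f (1 / conj z))` of a polynomial in one variable. -/
def conjReverse (n : ℕ) (f : Polynomial ℂ) : Polynomial ℂ :=
  ∑ k ∈ Finset.range (n + 1), Polynomial.C (conj (f.coeff k)) * Polynomial.X ^ (n - k)

theorem natDegree_conjReverse_le (n : ℕ) (f : Polynomial ℂ) : (conjReverse n f).natDegree ≤ n :=
  Polynomial.natDegree_sum_le_of_forall_le _ _ fun _ _ =>
    (Polynomial.natDegree_C_mul_X_pow_le _ _).trans (Nat.sub_le _ _)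

theorem coeff_conjReverse_self (n : ℕ) (f : Polynomial ℂ) :
    (conjReverse n f).coeff n = conj (f.coeff 0) := by
  simp only [conjReverse, Polynomial.finsetSum_coeff, Polynomial.coeff_C_mul_X_pow]
  rw [Finset.sum_eq_single 0]
  · simp
  · intro k hk hk0
    rw [if_neg]
    have := Finset.mem_range.1 hk
    omega
  · simp

theorem eval_conjReverse {n : ℕ} {f : Polynomial ℂ} (hf : f.natDegree ≤ n) (ζ : Circle) :
    (conjReverse n f).eval (ζ : ℂ) = (ζ : ℂ) ^ n * conj (f.eval (ζ : ℂ)) := by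
  rw [Polynomial.eval_eq_sum_range' (Nat.lt_succ_of_le hf), conjReverse, Polynomial.eval_finsetSum,
    map_sum, Finset.mul_sum]
  refine Finset.sum_congr rfl fun k hk => ?_
  have hk' : k ≤ n := Nat.lt_succ_iff.1 (Finset.mem_range.1 hk)
  simp only [Polynomial.eval_mul, Polynomial.eval_C, Polynomial.eval_pow, Polynomial.eval_X,
    map_mul, map_pow, ← Circle.coe_inv_eq_conj, Circle.coe_inv, inv_pow]
  rw [pow_sub₀ _ (Circle.coe_ne_zero ζ) hk']
  ring

theorem reflection_eq {n : ℕ} {p : MvPolynomial (Fin 2) ℂ} (h₁ : p.degreeOf 0 ≤ n)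
    (h₂ : p.degreeOf 1 ≤ 1) :
    reflection n 1 p = liftFst (conjReverse n (sndCoeff n 1 p)) +
      MvPolynomial.X 1 * liftFst (conjReverse n (sndCoeff n 0 p)) := by
  rw [reflection, sum_support_eq h₁ h₂ _ (fun s hs => by simp [hs])]
  simp only [liftFst, conjReverse, map_sum, map_mul, Polynomial.aeval_C, Polynomial.aeval_X,
    map_pow, Finset.mul_sum, MvPolynomial.algebraMap_eq]
  rw [Finset.sum_add_distrib, add_comm]
  congr 1 <;> refine Finset.sum_congr rfl fun k hk => ?_ <;>
    rw [coeff_sndCoeff (Nat.lt_succ_iff.1 (Finset.mem_range.1 hk))] <;>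
    simp only [biExp_zero, biExp_one]
  · simp
  · simp only [Nat.sub_zero, pow_one]; ring

theorem coeff_liftFst (f : Polynomial ℂ) (k i : ℕ) :
    (liftFst f).coeff (biExp k i) = if i = 0 then f.coeff k else 0 := by
  unfold liftFst
  induction f using Polynomial.induction_on' with
  | add f g hf hg => simp only [map_add, MvPolynomial.coeff_add, hf, hg]; split_ifs <;> simp
  | monomial j c =>
    rw [Polynomial.aeval_monomial, MvPolynomial.algebraMap_eq, MvPolynomial.C_mul_X_pow_eq_monomial,
      MvPolynomial.coeff_monomial, Polynomial.coeff_monomial]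
    have : Finsupp.single (0 : Fin 2) j = biExp k i ↔ i = 0 ∧ j = k := by
      constructor
      · intro h
        have h0 := DFunLike.congr_fun h 0
        have h1 := DFunLike.congr_fun h 1
        simp at h0 h1
        exact ⟨h1.symm, h0⟩
      · rintro ⟨rfl, rfl⟩; simp [biExp]
    simp only [this]
    split_ifs <;> simp_all

theorem sndCoeff_liftFst_add {n : ℕ} {f g : Polynomial ℂ} (hf : f.natDegree ≤ n)
    (hg : g.natDegree ≤ n) :
    sndCoeff n 0 (liftFst f + MvPolynomial.X 1 * liftFst g) = f ∧
      sndCoeff n 1 (liftFst f + MvPolynomial.X 1 * liftFst g) = g := by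
  have h0 : ∀ k, biExp k 1 - Finsupp.single 1 1 = biExp k 0 := by
    intro k; ext i; fin_cases i <;> simp [biExp]
  constructor
  · conv_rhs => rw [f.as_sum_range_C_mul_X_pow' (Nat.lt_succ_of_le hf)]
    refine Finset.sum_congr rfl fun k _ => ?_
    rw [MvPolynomial.coeff_add, MvPolynomial.coeff_X_mul', coeff_liftFst]
    simp [Finsupp.mem_support_iff]
  · conv_rhs => rw [g.as_sum_range_C_mul_X_pow' (Nat.lt_succ_of_le hg)]
    refine Finset.sum_congr rfl fun k _ => ?_
    rw [MvPolynomial.coeff_add, MvPolynomial.coeff_X_mul', coeff_liftFst, h0, coeff_liftFst]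
    simp [Finsupp.mem_support_iff]

/-- The homogenization in degree `n` of a polynomial in one variable. -/
def homEval (n : ℕ) (f : Polynomial ℂ) (x : ℂ × ℂ) : ℂ :=
  ∑ k ∈ Finset.range (n + 1), f.coeff k * (x.1 ^ k * x.2 ^ (n - k))

theorem homEval_finite {n : ℕ} {f : Polynomial ℂ} (hf : f.natDegree ≤ n) (z : ℂ) :
    homEval n f (z, 1) = f.eval z := by
  rw [Polynomial.eval_eq_sum_range' (Nat.lt_succ_of_le hf)]
  simp [homEval]

theorem homEval_infinity (n : ℕ) (f : Polynomial ℂ) : homEval n f (1, 0) = f.coeff n := by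
  rw [homEval, Finset.sum_eq_single n]
  · simp
  · intro k hk hkn
    have : n - k ≠ 0 := by have := Finset.mem_range.1 hk; omega
    simp [this]
  · simp

theorem bihomEval_eq {n : ℕ} {p : MvPolynomial (Fin 2) ℂ} (h : bidegree p = (n, 1)) (x y : ℂ × ℂ) :
    bihomEval p x y = y.2 * homEval n (sndCoeff n 0 p) x + y.1 * homEval n (sndCoeff n 1 p) x := by
  simp only [bidegree, Prod.mk.injEq] at h
  rw [bihomEval, sum_support_eq h.1.le h.2.le _ (fun s hs => by simp [hs]), h.1, h.2, homEval,
    homEval, Finset.mul_sum, Finset.mul_sum, ← Finset.sum_add_distrib]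
  refine Finset.sum_congr rfl fun k hk => ?_
  rw [coeff_sndCoeff (Nat.lt_succ_iff.1 (Finset.mem_range.1 hk)),
    coeff_sndCoeff (Nat.lt_succ_iff.1 (Finset.mem_range.1 hk))]
  simp only [biExp_zero, biExp_one]
  simp
  ring

theorem degreeOf_reflection_le (n m : ℕ) (p : MvPolynomial (Fin 2) ℂ) :
    (reflection n m p).degreeOf 0 ≤ n ∧ (reflection n m p).degreeOf 1 ≤ m := by
  classical
  have key : ∀ s ∈ (reflection n m p).support, s 0 ≤ n ∧ s 1 ≤ m := by
    intro s hs
    rw [MvPolynomial.mem_support_iff, reflection, MvPolynomial.coeff_sum] at hs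
    obtain ⟨t, -, ht⟩ := Finset.exists_ne_zero_of_sum_ne_zero hs
    have he : (MvPolynomial.C (conj (p.coeff t)) * MvPolynomial.X 0 ^ (n - t 0) *
        MvPolynomial.X 1 ^ (m - t 1) : MvPolynomial (Fin 2) ℂ)
        = MvPolynomial.monomial (biExp (n - t 0) (m - t 1)) (conj (p.coeff t)) := by
      rw [MvPolynomial.monomial_eq]
      simp [Finsupp.prod_fintype, mul_assoc]
    rw [he, MvPolynomial.coeff_monomial] at ht
    have := (ite_ne_right_iff.1 ht).1
    rw [← this]
    simp
  exact ⟨MvPolynomial.degreeOf_le_iff.2 fun s hs => (key s hs).1,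
    MvPolynomial.degreeOf_le_iff.2 fun s hs => (key s hs).2⟩

theorem sndCoeff_reflection {n : ℕ} {p : MvPolynomial (Fin 2) ℂ} (h₁ : p.degreeOf 0 ≤ n)
    (h₂ : p.degreeOf 1 ≤ 1) :
    sndCoeff n 0 (reflection n 1 p) = conjReverse n (sndCoeff n 1 p) ∧
      sndCoeff n 1 (reflection n 1 p) = conjReverse n (sndCoeff n 0 p) := by
  rw [reflection_eq h₁ h₂]
  exact sndCoeff_liftFst_add (natDegree_conjReverse_le _ _) (natDegree_conjReverse_le _ _)

/-- `P + z₂ Q` is zero free on the bidisk and has no zero line `z₁ = ζ` with `ζ` on the circle. -/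
structure IsStablePair (n : ℕ) (P Q : Polynomial ℂ) : Prop where
  degree_fst : P.natDegree ≤ n
  degree_snd : Q.natDegree ≤ n
  ne_zero : ∀ z ∈ bidisk, P.eval z.1 + z.2 * Q.eval z.1 ≠ 0
  no_line : ∀ ζ : Circle, P.eval (ζ : ℂ) = 0 → Q.eval (ζ : ℂ) ≠ 0

theorem evalAt_eq {n : ℕ} {p : MvPolynomial (Fin 2) ℂ} (h₁ : p.degreeOf 0 ≤ n)
    (h₂ : p.degreeOf 1 ≤ 1) (z : ℂ × ℂ) :
    evalAt p z = (sndCoeff n 0 p).eval z.1 + z.2 * (sndCoeff n 1 p).eval z.1 := by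
  conv_lhs => rw [eq_liftFst_add h₁ h₂]
  rw [← evalAt_liftFst, ← evalAt_liftFst]
  simp [evalAt]

theorem evalAt_reflection_eq {n : ℕ} {p : MvPolynomial (Fin 2) ℂ} (h₁ : p.degreeOf 0 ≤ n)
    (h₂ : p.degreeOf 1 ≤ 1) (z : ℂ × ℂ) :
    evalAt (reflection n 1 p) z = (conjReverse n (sndCoeff n 1 p)).eval z.1 +
      z.2 * (conjReverse n (sndCoeff n 0 p)).eval z.1 := by
  rw [evalAt_eq (degreeOf_reflection_le n 1 p).1 (degreeOf_reflection_le n 1 p).2,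
    (sndCoeff_reflection h₁ h₂).1, (sndCoeff_reflection h₁ h₂).2]

theorem IsRIFDenominator.isStablePair {n : ℕ} {p : MvPolynomial (Fin 2) ℂ}
    (hp : IsRIFDenominator n 1 p) : IsStablePair n (sndCoeff n 0 p) (sndCoeff n 1 p) where
  degree_fst := natDegree_sndCoeff_le _ _ _
  degree_snd := natDegree_sndCoeff_le _ _ _
  ne_zero z hz := by
    rw [← evalAt_eq hp.degree_fst hp.degree_snd]
    exact hp.ne_zero z hz
  -- A common zero ζ of P and Q on the circle is also a zero of both reflections, so z₁ - ζ would
  -- divide p and p̃.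
  no_line ζ h0 h1 := by
    have hdvd : ∀ f g : Polynomial ℂ, f.eval (ζ : ℂ) = 0 → g.eval (ζ : ℂ) = 0 →
        liftFst (Polynomial.X - Polynomial.C (ζ : ℂ)) ∣ liftFst f + MvPolynomial.X 1 * liftFst g := by
      intro f g hf hg
      exact dvd_add (map_dvd _ (Polynomial.dvd_iff_isRoot.2 hf))
        (Dvd.dvd.mul_left (map_dvd _ (Polynomial.dvd_iff_isRoot.2 hg)) _)
    have hu := hp.relPrime (d := liftFst (Polynomial.X - Polynomial.C (ζ : ℂ)))
      (by
        rw [reflection_eq hp.degree_fst hp.degree_snd]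
        apply hdvd
        · rw [eval_conjReverse (natDegree_sndCoeff_le _ _ _), h1]; simp
        · rw [eval_conjReverse (natDegree_sndCoeff_le _ _ _), h0]; simp)
      (by
        conv_rhs => rw [eq_liftFst_add hp.degree_fst hp.degree_snd]
        exact hdvd _ _ h0 h1)
    have := hu.map (MvPolynomial.eval ![(ζ : ℂ), 0])
    have he := evalAt_liftFst (Polynomial.X - Polynomial.C (ζ : ℂ)) ((ζ : ℂ), 0)
    simp only [evalAt, Polynomial.eval_sub, Polynomial.eval_X, Polynomial.eval_C, sub_self] at he
    rw [he] at this
    simp at this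

theorem bidegree_reflection {n : ℕ} {p : MvPolynomial (Fin 2) ℂ} (hp : IsRIFDenominator n 1 p) :
    bidegree (reflection n 1 p) = (n, 1) := by
  -- The top coefficient of p̃ is conj p(0, 0).
  have hc : (reflection n 1 p).coeff (biExp n 1) ≠ 0 := by
    rw [← coeff_sndCoeff le_rfl, (sndCoeff_reflection hp.degree_fst hp.degree_snd).2,
      coeff_conjReverse_self]
    have h := hp.isStablePair.ne_zero _ zero_mem_bidisk
    simp only [zero_mul, add_zero, ← Polynomial.coeff_zero_eq_eval_zero] at h
    simpa using h
  have hm := MvPolynomial.mem_support_iff.2 hc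
  have h0 := MvPolynomial.monomial_le_degreeOf 0 hm
  have h1 := MvPolynomial.monomial_le_degreeOf 1 hm
  rw [biExp_zero] at h0
  rw [biExp_one] at h1
  exact Prod.ext ((degreeOf_reflection_le n 1 p).1.antisymm h0)
    ((degreeOf_reflection_le n 1 p).2.antisymm h1)

/-- The resultant of `p` and its reflection in the second variable. -/
def reflectionResultant (n : ℕ) (P Q : Polynomial ℂ) : Polynomial ℂ :=
  P * conjReverse n P - Q * conjReverse n Q

/-- The kernel vector gives homogeneous coordinates of z₂ at a common zero of p and p̃; z₂ = ∞ is
allowed. -/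
theorem exists_kernel_of_det_eq_zero {a b c d : ℂ} (h : a * d - b * c = 0) :
    ∃ y : ℂ × ℂ, y ≠ 0 ∧ y.2 * a + y.1 * b = 0 ∧ y.2 * c + y.1 * d = 0 := by
  by_cases hab : a = 0 ∧ b = 0
  · by_cases hcd : c = 0 ∧ d = 0
    · exact ⟨(1, 1), by simp, by simp [hab], by simp [hcd]⟩
    · refine ⟨(c, -d), fun hy => hcd ?_, by simp [hab], by ring⟩
      simpa using hy
  · refine ⟨(a, -b), fun hy => hab ?_, by ring, by linear_combination h⟩
    simpa using hy

/-- A zero of the resultant at a point z₁ of the Riemann sphere extends to a common zero of p and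
p̃, hence lies on the circle. That z₁ = ∞ is not a zero means precisely that the degree is 2 n.
Equality of the bidegrees ensures that both polynomials are homogenized in bidegree (n, 1). -/
theorem IsTorusSaturated.resultant {n : ℕ} {p : MvPolynomial (Fin 2) ℂ}
    (hs : IsTorusSaturated n 1 p) (hp : IsRIFDenominator n 1 p)
    (hd : bidegree p = bidegree (reflection n 1 p)) :
    (reflectionResultant n (sndCoeff n 0 p) (sndCoeff n 1 p)).natDegree = 2 * n ∧
      ∀ z, (reflectionResultant n (sndCoeff n 0 p) (sndCoeff n 1 p)).eval z = 0 → ‖z‖ = 1 := by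
  have hd2 := bidegree_reflection hp
  have hd1 := hd.trans hd2
  obtain ⟨e0, e1⟩ := sndCoeff_reflection hp.degree_fst hp.degree_snd
  set P := sndCoeff n 0 p with hP
  set Q := sndCoeff n 1 p with hQ
  have hPd : P.natDegree ≤ n := natDegree_sndCoeff_le _ _ _
  have hQd : Q.natDegree ≤ n := natDegree_sndCoeff_le _ _ _
  have hP' := natDegree_conjReverse_le n P
  have hQ' := natDegree_conjReverse_le n Q
  have key : ∀ x : ℂ × ℂ, x ≠ 0 → homEval n P x * homEval n (conjReverse n P) x
      - homEval n Q x * homEval n (conjReverse n Q) x = 0 → ‖x.1‖ = ‖x.2‖ := by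
    intro x hx h
    obtain ⟨y, hy, h1, h2⟩ := exists_kernel_of_det_eq_zero h
    refine (hs x y hx hy ?_ ?_).1
    · rw [bihomEval_eq hd1, h1]
    · rw [bihomEval_eq hd2, e0, e1, h2]
  constructor
  · refine le_antisymm ?_ ?_
    · refine (Polynomial.natDegree_sub_le _ _).trans (max_le ?_ ?_) <;>
        refine Polynomial.natDegree_mul_le.trans ?_ <;> omega
    · refine Polynomial.le_natDegree_of_ne_zero fun h => ?_
      have h2 := key (1, 0) (by simp) (by
        simp only [homEval_infinity]
        rw [two_mul, reflectionResultant, Polynomial.coeff_sub,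
          Polynomial.coeff_mul_add_eq_of_natDegree_le hPd hP',
          Polynomial.coeff_mul_add_eq_of_natDegree_le hQd hQ'] at h
        exact h)
      simp at h2
  · intro z hz
    have h2 := key (z, 1) (by simp) (by
      rw [homEval_finite hPd, homEval_finite hP', homEval_finite hQd, homEval_finite hQ']
      simpa [reflectionResultant] using hz)
    simpa using h2

/-! ### The rational inner function of a stable pair -/

/-- The denominator `P + z₂ Q`. -/
def pairDen (P Q : Polynomial ℂ) (z : ℂ × ℂ) : ℂ := P.eval z.1 + z.2 * Q.eval z.1

/-- The rational inner function with denominator `P + z₂ Q`. -/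
def pairRif (n : ℕ) (P Q : Polynomial ℂ) (z : ℂ × ℂ) : ℂ :=
  pairDen (conjReverse n Q) (conjReverse n P) z / pairDen P Q z

theorem rif_eq_pairRif {n : ℕ} {p : MvPolynomial (Fin 2) ℂ} (hp : IsRIFDenominator n 1 p) :
    rif n 1 p = pairRif n (sndCoeff n 0 p) (sndCoeff n 1 p) := by
  funext z
  rw [rif, pairRif, evalAt_eq hp.degree_fst hp.degree_snd,
    evalAt_reflection_eq hp.degree_fst hp.degree_snd]
  rfl

theorem differentiable_pairDen (P Q : Polynomial ℂ) : Differentiable ℂ (pairDen P Q) := by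
  unfold pairDen
  have hP : Differentiable ℂ fun z : ℂ × ℂ => P.eval z.1 := P.differentiable.comp differentiable_fst
  have hQ : Differentiable ℂ fun z : ℂ × ℂ => Q.eval z.1 := Q.differentiable.comp differentiable_fst
  exact hP.add (differentiable_snd.mul hQ)

theorem differentiableOn_bidisk_div {f g : ℂ × ℂ → ℂ} (hf : DifferentiableOn ℂ f bidisk)
    (hg : DifferentiableOn ℂ g bidisk) (h0 : ∀ z ∈ bidisk, g z ≠ 0) :
    DifferentiableOn ℂ (fun z => f z / g z) bidisk := by
  simp only [div_eq_mul_inv]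
  exact hf.mul (hg.inv h0)

/-- The cross terms 2 Re (w b conj a) of the two squares agree and cancel. Applied with u = ζ^n, a =
P(ζ), b = Q(ζ), this computes |p|² - |p̃|² over |z₁| = 1. -/
theorem norm_sq_sub_norm_sq_reflected {u : ℂ} (hu : ‖u‖ = 1) (a b w : ℂ) :
    ‖a + w * b‖ ^ 2 - ‖u * conj b + w * (u * conj a)‖ ^ 2
      = (1 - ‖w‖ ^ 2) * (‖a‖ ^ 2 - ‖b‖ ^ 2) := by
  rw [show u * conj b + w * (u * conj a) = u * (conj b + w * conj a) by ring, norm_mul, hu, one_mul]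
  simp only [← Complex.normSq_eq_norm_sq, Complex.normSq_apply, Complex.add_re, Complex.add_im,
    Complex.mul_re, Complex.mul_im, Complex.conj_re, Complex.conj_im]
  ring

theorem tendsto_ofReal_mul_nhdsLT_one (ζ : ℂ) :
    Tendsto (fun r : ℝ => (r : ℂ) * ζ) (𝓝[<] 1) (𝓝 ζ) := by
  have h : Continuous fun r : ℝ => (r : ℂ) * ζ := by fun_prop
  simpa using (h.tendsto 1).mono_left nhdsWithin_le_nhds

theorem eventually_nhdsLT_one : ∀ᶠ r : ℝ in 𝓝[<] 1, 0 < r ∧ r < 1 :=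
  Ioo_mem_nhdsLT zero_lt_one

namespace IsStablePair

variable {n : ℕ} {P Q : Polynomial ℂ}

/-- Otherwise z₂ = -P/Q would give a zero of p in the bidisk. -/
theorem norm_eval_le (h : IsStablePair n P Q) {z : ℂ} (hz : ‖z‖ < 1) :
    ‖Q.eval z‖ ≤ ‖P.eval z‖ := by
  by_contra! hlt
  have hQ : Q.eval z ≠ 0 := norm_pos_iff.1 ((norm_nonneg _).trans_lt hlt)
  refine h.ne_zero (z, -(P.eval z / Q.eval z)) (mem_bidisk.2 ⟨hz, ?_⟩) ?_
  · rw [norm_neg, norm_div, div_lt_one (norm_pos_iff.2 hQ)]; exact hlt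
  · simp only; field_simp; ring

theorem norm_eval_circle_le (h : IsStablePair n P Q) (ζ : Circle) :
    ‖Q.eval (ζ : ℂ)‖ ≤ ‖P.eval (ζ : ℂ)‖ := by
  have hl := tendsto_ofReal_mul_nhdsLT_one (ζ : ℂ)
  refine le_of_tendsto_of_tendsto (((Q.continuous.tendsto _).comp hl).norm)
    (((P.continuous.tendsto _).comp hl).norm) ?_
  filter_upwards [eventually_nhdsLT_one] with r hr
  exact h.norm_eval_le (by rw [norm_ofReal_mul_circle, abs_of_pos hr.1]; exact hr.2)

/-- Since |Q| ≤ |P| persists on the circle, a zero of P there would be shared by Q. -/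
theorem eval_circle_ne_zero (h : IsStablePair n P Q) (ζ : Circle) : P.eval (ζ : ℂ) ≠ 0 := by
  intro h0
  have := h.norm_eval_circle_le ζ
  rw [h0, norm_zero] at this
  exact h.no_line ζ h0 (norm_le_zero_iff.1 this)

theorem pairDen_circle_ne_zero (h : IsStablePair n P Q) (ζ : Circle) {w : ℂ} (hw : ‖w‖ < 1) :
    pairDen P Q (ζ, w) ≠ 0 := by
  intro h0
  have h1 := norm_pos_iff.2 (h.eval_circle_ne_zero ζ)
  have h2 : P.eval (ζ : ℂ) = -(w * Q.eval (ζ : ℂ)) := eq_neg_of_add_eq_zero_left h0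
  have h3 := h.norm_eval_circle_le ζ
  rw [h2, norm_neg, norm_mul] at h1 h3
  nlinarith [norm_nonneg w, norm_nonneg (Q.eval (ζ : ℂ))]

theorem norm_sq_pairDen_sub (h : IsStablePair n P Q) (ζ : Circle) (w : ℂ) :
    ‖pairDen P Q (ζ, w)‖ ^ 2 - ‖pairDen (conjReverse n Q) (conjReverse n P) (ζ, w)‖ ^ 2
      = (1 - ‖w‖ ^ 2) * (‖P.eval (ζ : ℂ)‖ ^ 2 - ‖Q.eval (ζ : ℂ)‖ ^ 2) := by
  simp only [pairDen, eval_conjReverse h.degree_fst, eval_conjReverse h.degree_snd]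
  exact norm_sq_sub_norm_sq_reflected (by simp [Circle.norm_coe]) _ _ _

theorem exists_circle {z : ℂ} (hz : ‖z‖ = 1) : ∃ ζ : Circle, (ζ : ℂ) = z :=
  ⟨⟨z, by simpa [Submonoid.unitSphere] using hz⟩, rfl⟩

theorem diffContOnCl_of_ne_zero {A B C D : Polynomial ℂ} {w : ℂ} (hw : ‖w‖ < 1)
    (h₁ : ∀ z ∈ bidisk, pairDen A B z ≠ 0) (h₂ : ∀ ζ : Circle, pairDen A B (ζ, w) ≠ 0) :
    DiffContOnCl ℂ (fun z => pairDen C D (z, w) / pairDen A B (z, w)) (ball 0 1) := by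
  refine DifferentiableOn.diffContOnCl ?_
  rw [closure_ball _ one_ne_zero]
  have hd : ∀ E F : Polynomial ℂ, Differentiable ℂ fun z : ℂ => pairDen E F (z, w) := fun E F =>
    (differentiable_pairDen E F).comp (f := fun z : ℂ => (z, w)) (by fun_prop)
  refine (hd C D).differentiableOn.div (hd A B).differentiableOn fun z hz => ?_
  rcases (mem_closedBall_zero_iff.1 hz).lt_or_eq with hlt | heq
  · exact h₁ (z, w) (mem_bidisk.2 ⟨hlt, hw⟩)
  · obtain ⟨ζ, rfl⟩ := exists_circle heq
    exact h₂ ζ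

/-- Maximum principle in z₁ with z₂ fixed: on |z₁| = 1 the denominator has no zero and |p|² - |p̃|²
= (1 - |z₂|²)(|P|² - |Q|²) ≥ 0. -/
theorem norm_pairRif_le_one (h : IsStablePair n P Q) {z : ℂ × ℂ} (hz : z ∈ bidisk) :
    ‖pairRif n P Q z‖ ≤ 1 := by
  obtain ⟨hz1, hz2⟩ := mem_bidisk.1 hz
  have hd := diffContOnCl_of_ne_zero (C := conjReverse n Q) (D := conjReverse n P) hz2 h.ne_zero
    (fun ζ => h.pairDen_circle_ne_zero ζ hz2)
  refine Complex.norm_le_of_forall_mem_frontier_norm_le isBounded_ball hd (fun w hw => ?_)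
    (subset_closure (by simpa using hz1) : z.1 ∈ closure (ball (0 : ℂ) 1))
  rw [frontier_ball _ one_ne_zero, mem_sphere_zero_iff_norm] at hw
  obtain ⟨ζ, rfl⟩ := exists_circle hw
  rw [norm_div, div_le_one (norm_pos_iff.2 (h.pairDen_circle_ne_zero ζ hz2))]
  have h1 := h.norm_sq_pairDen_sub ζ z.2
  have h2 := h.norm_eval_circle_le ζ
  refine le_of_sq_le_sq ?_ (norm_nonneg _)
  have h3 : 0 ≤ (1 - ‖z.2‖ ^ 2) * (‖P.eval (ζ : ℂ)‖ ^ 2 - ‖Q.eval (ζ : ℂ)‖ ^ 2) :=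
    mul_nonneg (by nlinarith [norm_nonneg z.2]) (by nlinarith [norm_nonneg (Q.eval (ζ : ℂ))])
  linarith

theorem differentiableOn_pairRif (h : IsStablePair n P Q) :
    DifferentiableOn ℂ (pairRif n P Q) bidisk :=
  differentiableOn_bidisk_div (differentiable_pairDen _ _).differentiableOn
    (differentiable_pairDen _ _).differentiableOn h.ne_zero

/-- Schwarz's lemma on the disk t ↦ t z / ρ with ‖z‖ < ρ < 1, evaluated at t = ρ; then ρ decreases
to ‖z‖. Using ρ avoids a separate treatment of z = 0. -/
theorem norm_pairRif_le (h : IsStablePair n P Q) (h0 : pairRif n P Q (0, 0) = 0) {z : ℂ × ℂ}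
    (hz : z ∈ bidisk) : ‖pairRif n P Q z‖ ≤ ‖z‖ := by
  have hz1 : ‖z‖ < 1 := by
    rw [mem_bidisk] at hz
    exact max_lt hz.1 hz.2
  refine le_of_forall_gt_imp_ge_of_dense fun ρ hρ => ?_
  by_cases hρ1 : 1 ≤ ρ
  · exact (h.norm_pairRif_le_one hz).trans hρ1
  push Not at hρ1
  have hρ0 : 0 < ρ := (norm_nonneg z).trans_lt hρ
  have hmem : ∀ t ∈ ball (0 : ℂ) 1, (t * (z.1 / ρ), t * (z.2 / ρ)) ∈ bidisk := by
    intro t ht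
    have ht' : ‖t‖ < 1 := by simpa using ht
    have key : ∀ w : ℂ, ‖w‖ ≤ ‖z‖ → ‖t * (w / ρ)‖ < 1 := by
      intro w hw
      have h1 : ‖w / (ρ : ℂ)‖ < 1 := by
        rw [norm_div, Complex.norm_real, Real.norm_eq_abs, abs_of_pos hρ0, div_lt_one hρ0]
        exact hw.trans_lt hρ
      rw [norm_mul]
      nlinarith [norm_nonneg t, norm_nonneg (w / (ρ : ℂ))]
    exact mem_bidisk.2 ⟨key _ (norm_fst_le z), key _ (norm_snd_le z)⟩
  have hS := Complex.norm_le_norm_of_mapsTo_ball (R := 1) (z := (ρ : ℂ))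
    (f := fun t : ℂ => pairRif n P Q (t * (z.1 / ρ), t * (z.2 / ρ)))
    (h.differentiableOn_pairRif.comp (Differentiable.differentiableOn (by fun_prop)) hmem)
    (fun t ht => by simpa using h.norm_pairRif_le_one (hmem t ht)) (by simpa using h0)
    (by simpa [abs_of_pos hρ0] using hρ1)
  have hne : (ρ : ℂ) ≠ 0 := by exact_mod_cast hρ0.ne'
  simpa [mul_div_cancel₀ _ hne, abs_of_pos hρ0] using hS

theorem norm_pairRif_lt_one (h : IsStablePair n P Q) (h0 : pairRif n P Q (0, 0) = 0) {z : ℂ × ℂ}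
    (hz : z ∈ bidisk) : ‖pairRif n P Q z‖ < 1 :=
  (h.norm_pairRif_le h0 hz).trans_lt (by rw [mem_bidisk] at hz; exact max_lt hz.1 hz.2)

end IsStablePair

/-- The function `(α + φ) / (α - φ)`. -/
def clarkFunction (φ : ℂ × ℂ → ℂ) (α : Circle) (z : ℂ × ℂ) : ℂ := (α + φ z) / (α - φ z)

theorem re_clarkFunction (φ : ℂ × ℂ → ℂ) (α : Circle) (z : ℂ × ℂ) :
    (clarkFunction φ α z).re = (1 - ‖φ z‖ ^ 2) / ‖(α : ℂ) - φ z‖ ^ 2 := by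
  rw [clarkFunction, re_herglotz_div, Circle.norm_coe, one_pow]

namespace IsStablePair

variable {n : ℕ} {P Q : Polynomial ℂ}

theorem clarkFunction_mem (h : IsStablePair n P Q) (h0 : pairRif n P Q (0, 0) = 0) (α : Circle) :
    clarkFunction (pairRif n P Q) α ∈ caratheodoryClass₂ := by
  have hne : ∀ z ∈ bidisk, (α : ℂ) - pairRif n P Q z ≠ 0 := fun z hz =>
    circle_sub_ne_zero (h.norm_pairRif_lt_one h0 hz) α
  refine ⟨?_, fun z hz => ?_, ?_⟩
  · exact differentiableOn_bidisk_div ((differentiableOn_const _).add h.differentiableOn_pairRif)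
      ((differentiableOn_const _).sub h.differentiableOn_pairRif) hne
  · rw [re_clarkFunction]
    have h1 := h.norm_pairRif_lt_one h0 hz
    have h2 := norm_pos_iff.2 (hne z hz)
    exact div_pos (by nlinarith [norm_nonneg (pairRif n P Q z)]) (by positivity)
  · simp [clarkFunction, h0]

theorem exists_clark (h : IsStablePair n P Q) (h0 : pairRif n P Q (0, 0) = 0) (α : Circle) :
    ∃! σ : Measure (Circle × Circle), IsClarkMeasure (pairRif n P Q) α σ := by
  obtain ⟨σ, hσ, hP⟩ := exists_measure_of_caratheodory (h.clarkFunction_mem h0 α)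
  refine ⟨σ, ⟨inferInstance, hP⟩, fun ν hν => ?_⟩
  have := hν.1
  exact measure_eq_of_poisson_eq fun z hz => by rw [← hν.2 z hz]; exact hP z hz

end IsStablePair

/-! ### Restriction of pluriharmonic measures to lines `z₁ = τ` -/

/-- Wiener's device for isolating a point mass. The exponents start at 1, so that only positive
frequencies occur and the vanishing of mixed moments applies. -/
theorem tendsto_cesaro_circle (w : Circle) :
    Tendsto (fun N : ℕ => (N : ℂ)⁻¹ * ∑ j ∈ Finset.range N, (w : ℂ) ^ (j + 1)) atTop
      (𝓝 (({1} : Set Circle).indicator (fun _ => 1) w)) := by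
  by_cases hw : w = 1
  · rw [indicator_of_mem (by simpa using hw)]
    refine tendsto_const_nhds.congr' ?_
    filter_upwards [eventually_ne_atTop 0] with N hN
    have : (N : ℂ) ≠ 0 := by exact_mod_cast hN
    simp [hw, this]
  · rw [indicator_of_notMem (by simpa using hw)]
    have hw1 : (w : ℂ) - 1 ≠ 0 := by
      rw [sub_ne_zero]
      exact fun h => hw (Circle.ext (by simpa using h))
    have hb : ∀ N : ℕ, ‖∑ j ∈ Finset.range N, (w : ℂ) ^ (j + 1)‖ ≤ 2 / ‖(w : ℂ) - 1‖ := by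
      intro N
      simp only [pow_succ]
      rw [← Finset.sum_mul, geom_sum_eq (sub_ne_zero.1 hw1), norm_mul, Circle.norm_coe, mul_one,
        norm_div]
      gcongr
      refine (norm_sub_le _ _).trans ?_
      simp [Circle.norm_coe]
      norm_num
    rw [tendsto_zero_iff_norm_tendsto_zero]
    refine squeeze_zero (fun _ => norm_nonneg _) (fun N => ?_)
      (g := fun N : ℕ => (N : ℝ)⁻¹ * (2 / ‖(w : ℂ) - 1‖)) ?_
    · rw [norm_mul, norm_inv, Complex.norm_natCast]
      exact mul_le_mul_of_nonneg_left (hb N) (by positivity)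
    · simpa using (tendsto_inv_atTop_nhds_zero_nat (𝕜 := ℝ)).mul_const (2 / ‖(w : ℂ) - 1‖)

theorem norm_cesaro_circle_le (w : Circle) (N : ℕ) :
    ‖(N : ℂ)⁻¹ * ∑ j ∈ Finset.range N, (w : ℂ) ^ (j + 1)‖ ≤ 1 := by
  rw [norm_mul, norm_inv, Complex.norm_natCast]
  have h : ‖∑ j ∈ Finset.range N, (w : ℂ) ^ (j + 1)‖ ≤ N := by
    refine (norm_sum_le _ _).trans ?_
    simp [Circle.norm_coe]
  rcases N.eq_zero_or_pos with rfl | hN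
  · simp
  · have : (0 : ℝ) < N := by exact_mod_cast hN
    rw [inv_mul_le_iff₀ this, mul_one]
    exact h

/-- The line `z₁ = τ` of the torus. -/
def torusLine (τ : Circle) : Set (Circle × Circle) := Prod.fst ⁻¹' {τ}

theorem measurableSet_torusLine (τ : Circle) : MeasurableSet (torusLine τ) :=
  (isClosed_singleton.preimage continuous_fst).measurableSet

/-- The uniform probability measure on the line `z₁ = τ`. -/
def lineMeasure (τ : Circle) : Measure (Circle × Circle) := circleMeasure.map fun ζ => (τ, ζ)

instance isProbabilityMeasure_lineMeasure (τ : Circle) : IsProbabilityMeasure (lineMeasure τ) :=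
  Measure.isProbabilityMeasure_map (by fun_prop)

theorem integral_lineMeasure {E : Type*} [NormedAddCommGroup E] [NormedSpace ℝ E]
    [SecondCountableTopology E] {g : Circle × Circle → E} (hg : Continuous g) (τ : Circle) :
    ∫ ζ, g ζ ∂(lineMeasure τ) = ∫ ζ, g (τ, ζ) ∂circleMeasure :=
  integral_map (by fun_prop) hg.aestronglyMeasurable

theorem integral_poissonKernel₂_lineMeasure (τ : Circle) {z : ℂ × ℂ} (hz : z ∈ bidisk) :
    ∫ ζ, poissonKernel₂ z ζ ∂(lineMeasure τ) = diskPoisson z.1 τ := by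
  rw [integral_lineMeasure (continuous_poissonKernel₂ hz)]
  simp only [poissonKernel₂_eq_mul]
  rw [integral_const_mul, integral_diskPoisson (mem_bidisk.1 hz).2, mul_one]

/-- The indicator of the line is the bounded limit of the Cesàro means of (ζ₁/τ)^(j+1). Their
products with ζ₂^(-k) have frequencies of opposite signs, so their integrals vanish. -/
theorem setIntegral_torusLine_char_eq_zero {σ : Measure (Circle × Circle)} [IsFiniteMeasure σ]
    {F : ℂ × ℂ → ℂ} (hF : DifferentiableOn ℂ F bidisk)
    (h : ∀ z ∈ bidisk, (F z).re = ∫ ζ, poissonKernel₂ z ζ ∂σ) (τ : Circle) {k : ℕ} (hk : k ≠ 0) :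
    ∫ ζ in torusLine τ, torusChar 0 (-k) ζ ∂σ = 0 := by
  have hcc : ∀ N : ℕ, Continuous fun ζ : Circle × Circle => (N : ℂ)⁻¹ *
      (∑ j ∈ Finset.range N, ((ζ.1 / τ : Circle) : ℂ) ^ (j + 1)) * torusChar 0 (-k) ζ := by
    intro N
    have h0 : Continuous fun ζ : Circle × Circle => ζ.1 / τ := continuous_fst.div' continuous_const
    have h1 : Continuous fun ζ : Circle × Circle => ((ζ.1 / τ : Circle) : ℂ) :=
      continuous_subtype_val.comp h0
    exact (continuous_const.mul (continuous_finsetSum _ fun j _ => h1.pow _)).mul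
      (continuous_torusChar _ _)
  have hlim : Tendsto (fun N : ℕ => ∫ ζ, (N : ℂ)⁻¹ *
      (∑ j ∈ Finset.range N, ((ζ.1 / τ : Circle) : ℂ) ^ (j + 1)) * torusChar 0 (-k) ζ ∂σ) atTop
      (𝓝 (∫ ζ, ({1} : Set Circle).indicator (fun _ => 1) (ζ.1 / τ) * torusChar 0 (-k) ζ ∂σ)) := by
    refine tendsto_integral_of_dominated_convergence (fun _ => 1)
      (fun N => (hcc N).aestronglyMeasurable) (integrable_const _)
      (fun N => .of_forall fun ζ => ?_) (.of_forall fun ζ => ?_)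
    · rw [norm_mul, norm_torusChar, mul_one]
      exact norm_cesaro_circle_le _ N
    · exact (tendsto_cesaro_circle (ζ.1 / τ)).mul_const _
  have hzero : ∀ N : ℕ, ∫ ζ, (N : ℂ)⁻¹ *
      (∑ j ∈ Finset.range N, ((ζ.1 / τ : Circle) : ℂ) ^ (j + 1)) * torusChar 0 (-k) ζ ∂σ = 0 := by
    intro N
    have he : ∀ ζ : Circle × Circle, (N : ℂ)⁻¹ *
        (∑ j ∈ Finset.range N, ((ζ.1 / τ : Circle) : ℂ) ^ (j + 1)) * torusChar 0 (-k) ζ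
        = ∑ j ∈ Finset.range N, (N : ℂ)⁻¹ * ((τ : ℂ)⁻¹) ^ (j + 1) *
          torusChar ((j + 1 : ℕ) : ℤ) (-k) ζ := by
      intro ζ
      rw [Finset.mul_sum, Finset.sum_mul]
      refine Finset.sum_congr rfl fun j _ => ?_
      simp only [torusChar, Circle.coe_mul, Circle.coe_div, zpow_natCast, Circle.coe_pow, zpow_zero,
        Circle.coe_one]
      rw [div_pow, inv_pow]
      ring
    simp only [he]
    rw [integral_finsetSum _ fun j _ => integrable_of_continuous (by
      exact continuous_const.mul (continuous_torusChar _ _))]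
    refine Finset.sum_eq_zero fun j _ => ?_
    rw [integral_const_mul, integral_torusChar_mixed_eq_zero hF h (Nat.succ_ne_zero j) hk, mul_zero]
  simp only [hzero] at hlim
  rw [← integral_indicator (measurableSet_torusLine τ), ← tendsto_nhds_unique hlim tendsto_const_nhds]
  refine integral_congr_ae (.of_forall fun ζ => ?_)
  by_cases hζ : ζ.1 = τ
  · simp [torusLine, indicator, hζ]
  · simp [torusLine, indicator, hζ, div_eq_one]

/-- A measure with pluriharmonic Poisson integral is uniform on each line `z₁ = τ`. -/
theorem restrict_torusLine {σ : Measure (Circle × Circle)} [IsFiniteMeasure σ]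
    {F : ℂ × ℂ → ℂ} (hF : DifferentiableOn ℂ F bidisk)
    (h : ∀ z ∈ bidisk, (F z).re = ∫ ζ, poissonKernel₂ z ζ ∂σ) (τ : Circle) :
    σ.restrict (torusLine τ) = σ (torusLine τ) • lineMeasure τ := by
  have hfin : IsFiniteMeasure (σ (torusLine τ) • lineMeasure τ) :=
    (lineMeasure τ).smul_finite (measure_ne_top σ _)
  refine torus_measure_ext fun j k => ?_
  have h1 : ∫ ζ in torusLine τ, torusChar j k ζ ∂σ
      = ((τ ^ j : Circle) : ℂ) * ∫ ζ in torusLine τ, torusChar 0 k ζ ∂σ := by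
    rw [← integral_const_mul]
    refine setIntegral_congr_fun (measurableSet_torusLine τ) fun ζ hζ => ?_
    have hζ' : ζ.1 = τ := hζ
    simp [torusChar, hζ']
  have h2 : ∫ ζ, torusChar j k ζ ∂(lineMeasure τ)
      = ((τ ^ j : Circle) : ℂ) * ∫ ζ : Circle, ((ζ ^ k : Circle) : ℂ) ∂circleMeasure := by
    rw [integral_lineMeasure (continuous_torusChar j k), ← integral_const_mul]
    simp [torusChar]
  rw [integral_smul_measure, h1, h2]
  have hpow : ∀ m : ℕ, m ≠ 0 → ∫ ζ : Circle, ((ζ ^ (m : ℤ) : Circle) : ℂ) ∂circleMeasure = 0 := by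
    intro m hm
    simpa [hm] using integral_circle_eq_apply_zero (diffContOnCl_pow m)
  -- Only negative frequencies of ζ₂ have been treated; positive ones follow by conjugation, the
  -- measures being real.
  have hconj : ∀ (ν : Measure (Circle × Circle)) (m : ℤ),
      ∫ ζ, torusChar 0 m ζ ∂ν = conj (∫ ζ, torusChar 0 (-m) ζ ∂ν) := by
    intro ν m
    rw [← integral_conj]
    simp [conj_torusChar]
  obtain ⟨m, rfl | rfl⟩ := k.eq_nat_or_neg
  · rcases eq_or_ne m 0 with rfl | hm
    · simp [torusChar, measureReal_def, mul_comm]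
    · rw [hconj, setIntegral_torusLine_char_eq_zero hF h τ hm, hpow m hm]
      simp
  · rcases eq_or_ne m 0 with rfl | hm
    · simp [torusChar, measureReal_def, mul_comm]
    · rw [setIntegral_torusLine_char_eq_zero hF h τ hm]
      have : ∫ ζ : Circle, ((ζ ^ (-m : ℤ) : Circle) : ℂ) ∂circleMeasure = 0 := by
        have h3 := congrArg conj (hpow m hm)
        rw [← integral_conj] at h3
        simpa [← Circle.coe_inv_eq_conj] using h3
      rw [this]
      simp

/-- The mass on a line as a radial limit of the Poisson integral. -/
theorem tendsto_poisson_torusLine (σ : Measure (Circle × Circle)) [IsFiniteMeasure σ] (τ : Circle) :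
    Tendsto (fun r : ℝ => (1 - r) / (1 + r) * ∫ ζ, poissonKernel₂ (r * τ, 0) ζ ∂σ) (𝓝[<] 1)
      (𝓝 (σ.real (torusLine τ))) := by
  -- With this normalization the kernel is at most 1, equals 1 on the line and tends to 0 off it, so
  -- dominated convergence applies.
  have hval : ∀ r : ℝ, 0 < r → r < 1 → ∀ ζ : Circle × Circle,
      (1 - r) / (1 + r) * poissonKernel₂ (r * τ, 0) ζ = (1 - r) ^ 2 / ‖(ζ.1 : ℂ) - r * τ‖ ^ 2 := by
    intro r h0 h1 ζ
    rw [poissonKernel₂_eq_mul]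
    rw [diskPoisson_zero, mul_one, diskPoisson, norm_ofReal_mul_circle, abs_of_pos h0]
    have : 1 + r ≠ 0 := by positivity
    field_simp
    ring
  have hmem : ∀ r : ℝ, 0 < r → r < 1 → ((r : ℂ) * τ, (0 : ℂ)) ∈ bidisk := by
    intro r h0 h1
    rw [mem_bidisk]
    simp [Circle.norm_coe, abs_of_pos h0, h1]
  have hlim : Tendsto (fun r : ℝ => ∫ ζ, (1 - r) / (1 + r) * poissonKernel₂ (r * τ, 0) ζ ∂σ) (𝓝[<] 1)
      (𝓝 (∫ ζ, (torusLine τ).indicator (fun _ => (1 : ℝ)) ζ ∂σ)) := by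
    refine tendsto_integral_filter_of_dominated_convergence (fun _ => 1) ?_ ?_
      (integrable_const _) (.of_forall fun ζ => ?_)
    · filter_upwards [eventually_nhdsLT_one] with r hr
      exact (continuous_const.mul
        (continuous_poissonKernel₂ (hmem r hr.1 hr.2))).aestronglyMeasurable
    · filter_upwards [eventually_nhdsLT_one] with r hr
      refine .of_forall fun ζ => ?_
      rw [hval r hr.1 hr.2, Real.norm_of_nonneg (by positivity)]
      have h1 : 1 - r ≤ ‖(ζ.1 : ℂ) - r * τ‖ := by
        have := norm_sub_norm_le (ζ.1 : ℂ) (r * τ)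
        rwa [norm_ofReal_mul_circle, Circle.norm_coe, abs_of_pos hr.1] at this
      have h2 : 0 < 1 - r := by linarith [hr.2]
      rw [div_le_one (by have := h2.trans_le h1; positivity)]
      gcongr
    · by_cases hζ : ζ.1 = τ
      · refine tendsto_const_nhds.congr' ?_
        filter_upwards [eventually_nhdsLT_one] with r hr
        have h2 : 1 - r ≠ 0 := by linarith [hr.2]
        rw [hval r hr.1 hr.2, hζ, show (τ : ℂ) - r * τ = ((1 - r : ℝ) : ℂ) * τ by push_cast; ring,
          norm_ofReal_mul_circle, sq_abs, div_self (pow_ne_zero 2 h2)]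
        simp [torusLine, indicator, hζ]
      · have hne : ‖(ζ.1 : ℂ) - τ‖ ^ 2 ≠ 0 := by
          have h1 : (ζ.1 : ℂ) - τ ≠ 0 := sub_ne_zero.2 fun h => hζ (Circle.ext h)
          exact pow_ne_zero 2 (norm_ne_zero_iff.2 h1)
        have h2 : Tendsto (fun r : ℝ => (1 - r) ^ 2 / ‖(ζ.1 : ℂ) - r * τ‖ ^ 2) (𝓝[<] 1)
            (𝓝 ((1 - 1) ^ 2 / ‖(ζ.1 : ℂ) - τ‖ ^ 2)) := by
          refine Tendsto.div ?_ ?_ hne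
          · have : Continuous fun r : ℝ => (1 - r) ^ 2 := by fun_prop
            exact (this.tendsto 1).mono_left nhdsWithin_le_nhds
          · exact ((tendsto_ofReal_mul_nhdsLT_one (τ : ℂ)).const_sub _).norm.pow 2
        have h3 : (torusLine τ).indicator (fun _ => (1 : ℝ)) ζ = (1 - 1) ^ 2 / ‖(ζ.1 : ℂ) - τ‖ ^ 2 := by
          simp [torusLine, indicator, hζ]
        rw [h3]
        refine h2.congr' ?_
        filter_upwards [eventually_nhdsLT_one] with r hr
        exact (hval r hr.1 hr.2 ζ).symm
  simp only [integral_const_mul] at hlim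
  rwa [integral_indicator_const _ (measurableSet_torusLine τ), smul_eq_mul, mul_one] at hlim

/-! ### Exceptional values -/

/-- The value at `z₂ = 0` of `α p - p̃`. -/
def clarkPoly (n : ℕ) (P Q : Polynomial ℂ) (α : Circle) : Polynomial ℂ :=
  Polynomial.C (α : ℂ) * P - conjReverse n Q

theorem eval_clarkPoly (n : ℕ) (P Q : Polynomial ℂ) (α : Circle) (z : ℂ) :
    (clarkPoly n P Q α).eval z = α * P.eval z - (conjReverse n Q).eval z := by
  simp [clarkPoly]

theorem exists_eval_eq_add_mul (f : Polynomial ℂ) (τ : ℂ) :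
    ∃ g : Polynomial ℂ, ∀ z, f.eval z = f.eval τ + (z - τ) * g.eval z := by
  obtain ⟨g, hg⟩ := Polynomial.X_sub_C_dvd_sub_C_eval (p := f) (a := τ)
  refine ⟨g, fun z => ?_⟩
  have := congrArg (Polynomial.eval z) hg
  simp only [Polynomial.eval_sub, Polynomial.eval_C, Polynomial.eval_mul, Polynomial.eval_X] at this
  linear_combination this

namespace IsStablePair

variable {n : ℕ} {P Q : Polynomial ℂ}

/-- Write A = (z - τ) g. Along z = (r τ, 0) one has |α - φ| |P| = (1 - r) |g|, while Schwarz gives 1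
- |φ|² ≥ 1 - r². In the limit, mass · |g(τ)|² ≥ |P(τ)|² > 0. Multiplying by |g|² avoids having to
know beforehand that g(τ) ≠ 0. -/
theorem torusLine_mass_pos (h : IsStablePair n P Q) (h0 : pairRif n P Q (0, 0) = 0) {α : Circle}
    {σ : Measure (Circle × Circle)} (hσ : IsClarkMeasure (pairRif n P Q) α σ) {τ : Circle}
    (hτ : (clarkPoly n P Q α).eval (τ : ℂ) = 0) : 0 < σ.real (torusLine τ) := by
  have := hσ.1
  obtain ⟨g, hg⟩ := exists_eval_eq_add_mul (clarkPoly n P Q α) τ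
  simp only [hτ, zero_add] at hg
  have hl := tendsto_ofReal_mul_nhdsLT_one (τ : ℂ)
  have hlim := (tendsto_poisson_torusLine σ τ).mul ((((g.continuous.tendsto _).comp hl).norm).pow 2)
  have hP : Tendsto (fun r : ℝ => ‖P.eval ((r : ℂ) * τ)‖ ^ 2) (𝓝[<] 1)
      (𝓝 (‖P.eval (τ : ℂ)‖ ^ 2)) := (((P.continuous.tendsto _).comp hl).norm).pow 2
  have key := le_of_tendsto_of_tendsto hP hlim (by
    filter_upwards [eventually_nhdsLT_one] with r hr
    have hmem : ((r : ℂ) * τ, (0 : ℂ)) ∈ bidisk := by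
      rw [mem_bidisk]; simp [Circle.norm_coe, abs_of_pos hr.1, hr.2]
    have hPne : P.eval ((r : ℂ) * τ) ≠ 0 := by simpa using h.ne_zero _ hmem
    have hφ : pairRif n P Q ((r : ℂ) * τ, 0)
        = (conjReverse n Q).eval ((r : ℂ) * τ) / P.eval ((r : ℂ) * τ) := by
      simp [pairRif, pairDen]
    have hre : (clarkFunction (pairRif n P Q) α ((r : ℂ) * τ, 0)).re
        = ∫ ζ, poissonKernel₂ ((r : ℂ) * τ, 0) ζ ∂σ := hσ.2 _ hmem
    have hsch : ‖pairRif n P Q ((r : ℂ) * τ, 0)‖ ≤ r := by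
      refine (h.norm_pairRif_le h0 hmem).trans ?_
      rw [Prod.norm_def]
      simp [Circle.norm_coe, abs_of_pos hr.1, hr.1.le]
    have hsub : ‖(α : ℂ) - pairRif n P Q ((r : ℂ) * τ, 0)‖ * ‖P.eval ((r : ℂ) * τ)‖
        = (1 - r) * ‖g.eval ((r : ℂ) * τ)‖ := by
      have e1 : ((α : ℂ) - pairRif n P Q ((r : ℂ) * τ, 0)) * P.eval ((r : ℂ) * τ)
          = (((r - 1 : ℝ) : ℂ) * τ) * g.eval ((r : ℂ) * τ) := by
        have e2 := hg ((r : ℂ) * τ)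
        rw [eval_clarkPoly] at e2
        rw [hφ, sub_mul, div_mul_cancel₀ _ hPne, e2]
        push_cast
        ring
      rw [← norm_mul, e1, norm_mul, norm_ofReal_mul_circle, abs_of_neg (by linarith [hr.2])]
      ring
    have hne := norm_pos_iff.2 (circle_sub_ne_zero (h.norm_pairRif_lt_one h0 hmem) α)
    rw [re_clarkFunction] at hre
    rw [← hre]
    simp only [Function.comp_apply]
    set A := ‖(α : ℂ) - pairRif n P Q ((r : ℂ) * τ, 0)‖
    set N := ‖pairRif n P Q ((r : ℂ) * τ, 0)‖ with hN
    set X := ‖P.eval ((r : ℂ) * τ)‖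
    set G := ‖g.eval ((r : ℂ) * τ)‖
    have h1r : 0 < 1 - r := by linarith [hr.2]
    have h2r : 0 < 1 + r := by linarith [hr.1]
    have hG : G = A * X / (1 - r) := by field_simp; linarith [hsub]
    rw [hG]
    have : (1 - r) / (1 + r) * ((1 - N ^ 2) / A ^ 2) * (A * X / (1 - r)) ^ 2
        = X ^ 2 * ((1 - N ^ 2) / (1 - r ^ 2)) := by
      rw [show 1 - r ^ 2 = (1 - r) * (1 + r) by ring]
      field_simp
    rw [this]
    refine le_mul_of_one_le_right (by positivity) ?_
    rw [one_le_div (by nlinarith)]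
    have : 0 ≤ N := norm_nonneg _
    nlinarith)
  have hpos : 0 < ‖P.eval (τ : ℂ)‖ ^ 2 := by
    have := norm_pos_iff.2 (h.eval_circle_ne_zero τ)
    positivity
  exact pos_of_mul_pos_left (hpos.trans_le key) (by positivity)

/-- Converts a lower bound on the Clark function into an upper bound on |α - φ|. -/
theorem clarkFunction_add_one (h : IsStablePair n P Q) (h0 : pairRif n P Q (0, 0) = 0) (α : Circle)
    {z : ℂ × ℂ} (hz : z ∈ bidisk) :
    ((α : ℂ) - pairRif n P Q z) * (clarkFunction (pairRif n P Q) α z + 1) = 2 * α := by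
  have hne := circle_sub_ne_zero (h.norm_pairRif_lt_one h0 hz) α
  rw [clarkFunction]
  field_simp
  ring

/-- The Poisson integral of a Clark measure dominates the contribution of a line. -/
theorem mass_mul_diskPoisson_le (h : IsStablePair n P Q) (h0 : pairRif n P Q (0, 0) = 0) {α : Circle}
    {σ : Measure (Circle × Circle)} (hσ : IsClarkMeasure (pairRif n P Q) α σ) (τ : Circle)
    {z : ℂ × ℂ} (hz : z ∈ bidisk) :
    σ.real (torusLine τ) * diskPoisson z.1 τ ≤ (clarkFunction (pairRif n P Q) α z).re := by
  have := hσ.1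
  have hr := restrict_torusLine (h.clarkFunction_mem h0 α).1 hσ.2 τ
  have h1 : ∫ ζ in torusLine τ, poissonKernel₂ z ζ ∂σ = σ.real (torusLine τ) * diskPoisson z.1 τ := by
    rw [hr, integral_smul_measure, integral_poissonKernel₂_lineMeasure τ hz, smul_eq_mul,
      measureReal_def]
  rw [← h1]
  refine (setIntegral_le_integral (integrable_of_continuous (continuous_poissonKernel₂ hz))
    (.of_forall fun ζ => (poissonKernel₂_pos hz ζ).le)).trans (hσ.2 z hz).ge

/-- The mass m of the line bounds the real part of the Clark function below by m / (C |τ₁ - z₁|) in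
the approach region, hence |α - φ| ≤ (2 C / m) |τ₁ - z₁|. The second coordinate of τ plays no role.
-/
theorem hasNontangentialValue (h : IsStablePair n P Q) (h0 : pairRif n P Q (0, 0) = 0) {α : Circle}
    {τ : Circle × Circle} (hτ : (clarkPoly n P Q α).eval (τ.1 : ℂ) = 0) :
    HasNontangentialValue (pairRif n P Q) τ α := by
  obtain ⟨σ, hσ, -⟩ := h.exists_clark h0 α
  have hm := h.torusLine_mass_pos h0 hσ hτ
  set m := σ.real (torusLine τ.1)
  intro C hC
  rw [tendsto_iff_norm_sub_tendsto_zero]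
  refine squeeze_zero' (g := fun z : ℂ × ℂ => 2 * C / m * ‖(τ.1 : ℂ) - z.1‖)
    (.of_forall fun _ => norm_nonneg _) ?_ ?_
  · filter_upwards [self_mem_nhdsWithin] with z hz
    obtain ⟨hz, hzC⟩ := hz
    have hz' := mem_bidisk.1 hz
    have h1 := h.mass_mul_diskPoisson_le h0 hσ τ.1 hz
    have h2 := congrArg norm (h.clarkFunction_add_one h0 α hz)
    rw [norm_mul, norm_mul, Circle.norm_coe, mul_one, Complex.norm_ofNat] at h2
    have hd : 0 < ‖(τ.1 : ℂ) - z.1‖ := norm_pos_iff.2 (circle_sub_ne_zero hz'.1 τ.1)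
    have h3 : ‖(τ.1 : ℂ) - z.1‖ ≤ C * (1 - ‖z.1‖) := by
      have e1 : ‖(τ.1 : ℂ) - z.1‖ ≤ ‖z - torusPt τ‖ := by
        rw [norm_sub_rev]
        exact norm_fst_le (z - torusPt τ)
      have e2 : C * (1 - ‖z‖) ≤ C * (1 - ‖z.1‖) :=
        mul_le_mul_of_nonneg_left (by linarith [norm_fst_le z]) hC.le
      exact e1.trans (hzC.trans e2)
    have h4 : m / (C * ‖(τ.1 : ℂ) - z.1‖) ≤ m * diskPoisson z.1 τ.1 := by
      rw [div_eq_mul_one_div]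
      refine mul_le_mul_of_nonneg_left ?_ hm.le
      rw [diskPoisson, div_le_div_iff₀ (by positivity) (by positivity)]
      have e3 : 1 - ‖z.1‖ ≤ 1 - ‖z.1‖ ^ 2 := by nlinarith [norm_nonneg z.1, hz'.1]
      have e4 : ‖(τ.1 : ℂ) - z.1‖ ≤ C * (1 - ‖z.1‖ ^ 2) :=
        h3.trans (mul_le_mul_of_nonneg_left e3 hC.le)
      nlinarith
    have h5 : m / (C * ‖(τ.1 : ℂ) - z.1‖) ≤ ‖clarkFunction (pairRif n P Q) α z + 1‖ := by
      have e5 := Complex.re_le_norm (clarkFunction (pairRif n P Q) α z + 1)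
      rw [Complex.add_re, Complex.one_re] at e5
      linarith
    rw [norm_sub_rev]
    have h6 : ‖(α : ℂ) - pairRif n P Q z‖ * (m / (C * ‖(τ.1 : ℂ) - z.1‖)) ≤ 2 := by
      rw [← h2]
      exact mul_le_mul_of_nonneg_left h5 (norm_nonneg _)
    rw [← mul_div_assoc, div_le_iff₀ (by positivity)] at h6
    rw [div_mul_eq_mul_div, le_div_iff₀ hm]
    linarith
  · have hc : Continuous fun z : ℂ × ℂ => 2 * C / m * ‖(τ.1 : ℂ) - z.1‖ := by fun_prop
    have := (hc.tendsto (torusPt τ)).mono_left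
      (nhdsWithin_le_nhds (s := {z | z ∈ bidisk ∧ ‖z - torusPt τ‖ ≤ C * (1 - ‖z‖)}))
    simpa [torusPt] using this

/-- If the Clark polynomial vanishes at `τ₁`, then `p` vanishes at a point above `τ₁`. -/
theorem exists_zero_of_clarkPoly (h : IsStablePair n P Q) {α τ₁ : Circle}
    (hτ : (clarkPoly n P Q α).eval (τ₁ : ℂ) = 0) :
    ∃ τ₂ : Circle, pairDen P Q ((τ₁ : ℂ), (τ₂ : ℂ)) = 0 := by
  have hP := h.eval_circle_ne_zero τ₁
  rw [eval_clarkPoly, eval_conjReverse h.degree_snd, sub_eq_zero] at hτ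
  -- Vanishing of A at τ₁ forces |P| = |Q| there, so -P/Q is a point of the circle.
  have hn := congrArg norm hτ
  simp only [norm_mul, norm_pow, Circle.norm_coe, one_pow, one_mul, RCLike.norm_conj] at hn
  have hQ : Q.eval (τ₁ : ℂ) ≠ 0 := norm_ne_zero_iff.1 (hn ▸ norm_ne_zero_iff.2 hP)
  obtain ⟨τ₂, hτ₂⟩ := exists_circle (z := -(P.eval (τ₁ : ℂ) / Q.eval (τ₁ : ℂ))) (by
    rw [norm_neg, norm_div, hn, div_self (norm_ne_zero_iff.2 hQ)])
  refine ⟨τ₂, ?_⟩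
  simp only [pairDen, hτ₂]
  field_simp
  ring

/-- Approach τ along ((1 - ε s) τ₁, (1 - s) τ₂), which is nontangential with constant 1/ε. Since p
and p̃ vanish at τ, both are s times a quantity whose limit is affine in ε; comparing these limits
gives α P(τ₁) = Q~(τ₁) as the term of order 0 in ε. -/
theorem clarkPoly_eq_zero_of_hasNontangentialValue (h : IsStablePair n P Q) {α : Circle}
    {τ : Circle × Circle} (hp : pairDen P Q (torusPt τ) = 0)
    (hτ : HasNontangentialValue (pairRif n P Q) τ α) :
    (clarkPoly n P Q α).eval (τ.1 : ℂ) = 0 := by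
  obtain ⟨P₁, hP₁⟩ := exists_eval_eq_add_mul P τ.1
  obtain ⟨Q₁, hQ₁⟩ := exists_eval_eq_add_mul Q τ.1
  obtain ⟨P₂, hP₂⟩ := exists_eval_eq_add_mul (conjReverse n P) τ.1
  obtain ⟨Q₂, hQ₂⟩ := exists_eval_eq_add_mul (conjReverse n Q) τ.1
  have hpq : P.eval (τ.1 : ℂ) = -(τ.2 * Q.eval (τ.1 : ℂ)) := eq_neg_of_add_eq_zero_left hp
  have hpq' : (conjReverse n Q).eval (τ.1 : ℂ) = -(τ.2 * (conjReverse n P).eval (τ.1 : ℂ)) := by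
    rw [eval_conjReverse h.degree_fst, eval_conjReverse h.degree_snd, hpq, map_neg, map_mul]
    have : (τ.2 : ℂ) * conj (τ.2 : ℂ) = 1 := by
      rw [Complex.mul_conj, Circle.normSq_coe]; simp
    linear_combination (-(τ.1 : ℂ) ^ n * conj (Q.eval (τ.1 : ℂ))) * this
  have main : ∀ ε : ℝ, 0 < ε → ε ≤ 1 →
      α * (P.eval (τ.1 : ℂ) - ε * τ.1 * pairDen P₁ Q₁ (torusPt τ))
        = (conjReverse n Q).eval (τ.1 : ℂ) - ε * τ.1 * pairDen Q₂ P₂ (torusPt τ) := by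
    intro ε hε hε1
    let γ : ℝ → ℂ × ℂ := fun s => (((1 - ε * s : ℝ) : ℂ) * τ.1, ((1 - s : ℝ) : ℂ) * τ.2)
    have hγc : Continuous γ := by fun_prop
    have hγ0 : γ 0 = torusPt τ := by simp [γ, torusPt]
    have hmem : ∀ᶠ s : ℝ in 𝓝[>] 0, 0 < s ∧ γ s ∈ bidisk ∧
        ‖γ s - torusPt τ‖ ≤ ε⁻¹ * (1 - ‖γ s‖) := by
      filter_upwards [Ioo_mem_nhdsGT (zero_lt_one (α := ℝ))] with s hs
      have h1 : 0 < 1 - s := by linarith [hs.2]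
      have h2 : ε * s ≤ s := by nlinarith [hs.1]
      have h3 : 0 < ε * s := mul_pos hε hs.1
      have n1 : ‖(γ s).1‖ = 1 - ε * s := by
        simp only [γ]
        rw [norm_ofReal_mul_circle, abs_of_pos (by linarith)]
      have n2 : ‖(γ s).2‖ = 1 - s := by
        simp only [γ]
        rw [norm_ofReal_mul_circle, abs_of_pos h1]
      have hn : ‖γ s‖ = 1 - ε * s := by
        rw [Prod.norm_def, n1, n2, max_eq_left (by linarith)]
      refine ⟨hs.1, mem_bidisk.2 ⟨by rw [n1]; linarith, by rw [n2]; linarith [hs.1]⟩, ?_⟩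
      rw [hn, show ε⁻¹ * (1 - (1 - ε * s)) = s by field_simp; ring, Prod.norm_def]
      refine max_le ?_ ?_
      · have : (γ s - torusPt τ).1 = ((-(ε * s) : ℝ) : ℂ) * τ.1 := by
          simp only [γ, torusPt, Prod.fst_sub]; push_cast; ring
        rw [this, norm_ofReal_mul_circle, abs_neg, abs_of_pos h3]
        exact h2
      · have : (γ s - torusPt τ).2 = ((-s : ℝ) : ℂ) * τ.2 := by
          simp only [γ, torusPt, Prod.snd_sub]; push_cast; ring
        rw [this, norm_ofReal_mul_circle, abs_neg, abs_of_pos hs.1]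
    have hγl : Tendsto γ (𝓝[>] 0) (𝓝 (torusPt τ)) := by
      rw [← hγ0]; exact (hγc.tendsto 0).mono_left nhdsWithin_le_nhds
    have hφ : Tendsto (fun s => pairRif n P Q (γ s)) (𝓝[>] 0) (𝓝 (α : ℂ)) := by
      refine (hτ ε⁻¹ (inv_pos.2 hε)).comp (tendsto_nhdsWithin_iff.2 ⟨hγl, ?_⟩)
      filter_upwards [hmem] with s hs using hs.2
    have hE : ∀ A B : Polynomial ℂ, Tendsto (fun s => pairDen A B (γ s)) (𝓝[>] 0)
        (𝓝 (pairDen A B (torusPt τ))) := fun A B =>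
      ((differentiable_pairDen A B).continuous.tendsto _).comp hγl
    have hL := hφ.mul (((hE P₁ Q₁).const_mul ((ε : ℂ) * τ.1)).const_sub (P.eval (τ.1 : ℂ)))
    have hR := ((hE Q₂ P₂).const_mul ((ε : ℂ) * τ.1)).const_sub ((conjReverse n Q).eval (τ.1 : ℂ))
    refine tendsto_nhds_unique hL (hR.congr' ?_)
    filter_upwards [hmem] with s hs
    have hden : pairDen P Q (γ s) ≠ 0 := h.ne_zero _ hs.2.1
    have hs0 : (s : ℂ) ≠ 0 := by exact_mod_cast hs.1.ne'
    have e1 : pairDen P Q (γ s) = s * (P.eval (τ.1 : ℂ) - ε * τ.1 * pairDen P₁ Q₁ (γ s)) := by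
      simp only [pairDen, hP₁ (γ s).1, hQ₁ (γ s).1]
      simp only [γ]
      push_cast
      linear_combination (1 - (s : ℂ)) * hpq
    have e2 : pairDen (conjReverse n Q) (conjReverse n P) (γ s)
        = s * ((conjReverse n Q).eval (τ.1 : ℂ) - ε * τ.1 * pairDen Q₂ P₂ (γ s)) := by
      simp only [pairDen, hP₂ (γ s).1, hQ₂ (γ s).1]
      simp only [γ]
      push_cast
      linear_combination (1 - (s : ℂ)) * hpq'
    refine mul_left_cancel₀ hs0 ?_
    rw [← e2, mul_left_comm, ← e1, pairRif, div_mul_cancel₀ _ hden]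
  -- Both sides are affine in ε, so the values at 1 and 1/2 extrapolate to ε = 0.
  have m1 := main 1 one_pos le_rfl
  have m2 := main (1 / 2) (by norm_num) (by norm_num)
  push_cast at m1 m2
  rw [eval_clarkPoly]
  linear_combination 2 * m2 - m1

end IsStablePair

/-! ### Clark measures charging a line are not extreme -/

theorem isProbabilityMeasure_of_poisson {F : ℂ × ℂ → ℂ} (hF : F (0, 0) = 1)
    {σ : Measure (Circle × Circle)} [IsFiniteMeasure σ]
    (h : ∀ z ∈ bidisk, (F z).re = ∫ ζ, poissonKernel₂ z ζ ∂σ) : IsProbabilityMeasure σ := by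
  have h1 := h _ zero_mem_bidisk
  simp only [hF, poissonKernel₂_zero, Complex.one_re, integral_const, smul_eq_mul, mul_one] at h1
  exact ⟨by simpa [measureReal_def, ENNReal.toReal_eq_one_iff] using h1.symm⟩

theorem IsStablePair.clark_mem {n : ℕ} {P Q : Polynomial ℂ} (h : IsStablePair n P Q)
    (h0 : pairRif n P Q (0, 0) = 0) {α : Circle} {σ : Measure (Circle × Circle)}
    (hσ : IsClarkMeasure (pairRif n P Q) α σ) : σ ∈ pluriharmonicMeasures := by
  have := hσ.1
  have hf := h.clarkFunction_mem h0 α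
  exact ⟨isProbabilityMeasure_of_poisson hf.2.2 hσ.2, _, hf, hσ.2⟩

/-- The function represented by the uniform measure on a line. -/
def lineFunction (τ : Circle) (z : ℂ × ℂ) : ℂ := (τ + z.1) / (τ - z.1)

theorem lineFunction_mem (τ : Circle) : lineFunction τ ∈ caratheodoryClass₂ := by
  refine ⟨differentiableOn_bidisk_div (Differentiable.differentiableOn (by fun_prop))
    (Differentiable.differentiableOn (by fun_prop))
    (fun z hz => circle_sub_ne_zero (mem_bidisk.1 hz).1 τ), fun z hz => ?_, by simp [lineFunction]⟩
  rw [lineFunction, ← diskPoisson_eq_re]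
  exact diskPoisson_pos (mem_bidisk.1 hz).1 τ

theorem re_lineFunction (τ : Circle) {z : ℂ × ℂ} (hz : z ∈ bidisk) :
    (lineFunction τ z).re = ∫ ζ, poissonKernel₂ z ζ ∂(lineMeasure τ) := by
  rw [integral_poissonKernel₂_lineMeasure τ hz, lineFunction, diskPoisson_eq_re]

theorem lineMeasure_mem (τ : Circle) : lineMeasure τ ∈ pluriharmonicMeasures :=
  ⟨inferInstance, _, lineFunction_mem τ, fun _ hz => re_lineFunction τ hz⟩

/-- The restriction of μ to the line is a multiple of an admissible measure, so the normalized
remainder is admissible too. Extremality identifies the two pieces of this convex decomposition; if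
the line carries all the mass there is nothing to split. -/
theorem eq_lineMeasure_of_mem_extremePoints {μ : Measure (Circle × Circle)}
    (hμ : μ ∈ extremePoints ℝ≥0 pluriharmonicMeasures) {τ : Circle}
    (hτ : 0 < μ.real (torusLine τ)) : μ = lineMeasure τ := by
  obtain ⟨⟨hprob, F, hF, hFμ⟩, hext⟩ := mem_extremePoints.1 hμ
  have hr := restrict_torusLine hF.1 hFμ τ
  have hsum := Measure.restrict_add_restrict_compl (μ := μ) (measurableSet_torusLine τ)
  set c : ℝ≥0 := (μ (torusLine τ)).toNNReal with hc
  have hcc : μ (torusLine τ) = c := (ENNReal.coe_toNNReal (measure_ne_top μ _)).symm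
  have hcr : μ.real (torusLine τ) = c := by rw [measureReal_def, hcc]; simp
  have hc0 : 0 < c := by rw [hcr] at hτ; exact_mod_cast hτ
  have hc1 : c ≤ 1 := by
    have : μ (torusLine τ) ≤ 1 := prob_le_one
    rw [hcc] at this
    exact_mod_cast this
  rw [hcc] at hr
  have hr' : μ.restrict (torusLine τ) = c • lineMeasure τ := hr
  rcases hc1.eq_or_lt with h1 | h1
  · have h2 : μ (torusLine τ)ᶜ = 0 := by
      rw [prob_compl_eq_zero_iff (measurableSet_torusLine τ), hcc, h1]; simp
    rw [Measure.restrict_eq_zero.2 h2, add_zero, hr', h1, one_smul] at hsum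
    exact hsum.symm
  · set d : ℝ≥0 := 1 - c with hd
    have hd0 : 0 < d := tsub_pos_of_lt h1
    have hcd : c + d = 1 := add_tsub_cancel_of_le hc1
    have hcd' : (c : ℝ) + d = 1 := by exact_mod_cast hcd
    have hd0' : (d : ℂ) ≠ 0 := by exact_mod_cast hd0.ne'
    set ν : Measure (Circle × Circle) := d⁻¹ • μ.restrict (torusLine τ)ᶜ with hν
    have hμν : μ = c • lineMeasure τ + d • ν := by
      rw [hν, smul_smul, mul_inv_cancel₀ hd0.ne', one_smul, ← hr', hsum]
    have hνfin : IsFiniteMeasure ν := inferInstance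
    -- Solves F = c L + d G, where L is the function of the line; positivity of Re G will come from
    -- the measure ν.
    let G : ℂ × ℂ → ℂ := fun z => (d : ℂ)⁻¹ * (F z - c * lineFunction τ z)
    have hGν : ∀ z ∈ bidisk, (G z).re = ∫ ζ, poissonKernel₂ z ζ ∂ν := by
      intro z hz
      have e1 := hFμ z hz
      have hi : ∀ (ρ : Measure (Circle × Circle)) [IsFiniteMeasure ρ],
          Integrable (poissonKernel₂ z) ρ := fun ρ _ =>
        integrable_of_continuous (continuous_poissonKernel₂ hz)
      rw [hμν, integral_add_measure (hi _) (hi _), integral_smul_nnreal_measure,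
        integral_smul_nnreal_measure, ← re_lineFunction τ hz] at e1
      have e2 : (G z).re = (d : ℝ)⁻¹ * ((F z).re - c * (lineFunction τ z).re) := by
        have : G z = (((d : ℝ)⁻¹ : ℝ) : ℂ) * (F z - ((c : ℝ) : ℂ) * lineFunction τ z) := by
          simp [G]
        rw [this, Complex.re_ofReal_mul, Complex.sub_re, Complex.re_ofReal_mul]
      have hd1 : (d : ℝ) ≠ 0 := by exact_mod_cast hd0.ne'
      rw [e2, e1, NNReal.smul_def, NNReal.smul_def, smul_eq_mul, smul_eq_mul]
      field_simp
      ring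
    have hG0 : G (0, 0) = 1 := by
      simp only [G, hF.2.2, (lineFunction_mem τ).2.2]
      have : (c : ℂ) + d = 1 := by exact_mod_cast hcd'
      field_simp
      linear_combination -this
    have hνp : IsProbabilityMeasure ν := isProbabilityMeasure_of_poisson hG0 hGν
    have hνM : ν ∈ pluriharmonicMeasures := by
      refine ⟨hνp, G, ⟨?_, fun z hz => ?_, hG0⟩, hGν⟩
      · exact (differentiableOn_const _).mul
          (hF.1.sub ((differentiableOn_const _).mul (lineFunction_mem τ).1))
      · rw [hGν z hz]
        refine (integral_pos_iff_support_of_nonneg (fun ζ => (poissonKernel₂_pos hz ζ).le)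
          (integrable_of_continuous (continuous_poissonKernel₂ hz))).2 ?_
        have : Function.support (poissonKernel₂ z) = univ :=
          eq_univ_of_forall fun ζ => (poissonKernel₂_pos hz ζ).ne'
        rw [this, measure_univ]
        exact one_pos
    exact (hext _ (lineMeasure_mem τ) _ hνM ⟨c, d, hc0, hd0, hcd, hμν.symm⟩).1.symm

/-- On the complex line through 0 and z the difference is holomorphic with zero real part on a
connected set, hence constant, and it vanishes at 0. -/
theorem eqOn_bidisk_of_re_eq {F G : ℂ × ℂ → ℂ} (hF : DifferentiableOn ℂ F bidisk)
    (hG : DifferentiableOn ℂ G bidisk) (h0 : F (0, 0) = G (0, 0))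
    (h : ∀ z ∈ bidisk, (F z).re = (G z).re) {z : ℂ × ℂ} (hz : z ∈ bidisk) : F z = G z := by
  let ℓ : ℂ →ₗ[ℝ] ℂ × ℂ := (LinearMap.toSpanSingleton ℂ (ℂ × ℂ) z).restrictScalars ℝ
  let U : Set ℂ := ℓ ⁻¹' bidisk
  have hℓ : ∀ t, ℓ t = t • z := fun t => rfl
  have hℓd : Differentiable ℂ fun t : ℂ => t • z := by fun_prop
  have hUo : IsOpen U := isOpen_bidisk.preimage hℓd.continuous
  have h0U : (0 : ℂ) ∈ U := by
    change ℓ 0 ∈ bidisk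
    rw [map_zero]; exact zero_mem_bidisk
  have h1U : (1 : ℂ) ∈ U := by
    change ℓ 1 ∈ bidisk
    rw [hℓ, one_smul]; exact hz
  have hUc : Convex ℝ U := ((convex_ball _ _).prod (convex_ball _ _)).linear_preimage ℓ
  have hd : DifferentiableOn ℂ (fun t : ℂ => F (t • z) - G (t • z)) U :=
    (hF.comp hℓd.differentiableOn fun t ht => ht).sub (hG.comp hℓd.differentiableOn fun t ht => ht)
  obtain ⟨c, hc⟩ := (hd.analyticOnNhd hUo).eq_const_of_re_eq_const (c₀ := 0)
    (fun t ht => by rw [Complex.sub_re, h (t • z) ht, sub_self]) hUo ⟨⟨0, h0U⟩, hUc.isPreconnected⟩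
  have hc0 := hc 0 h0U
  have hc1 := hc 1 h1U
  rw [zero_smul, show (0 : ℂ × ℂ) = (0, 0) from rfl, h0, sub_self] at hc0
  rw [one_smul, ← hc0] at hc1
  exact sub_eq_zero.1 hc1

theorem polynomial_eq_of_eval_ball {f g : Polynomial ℂ} (h : ∀ z : ℂ, ‖z‖ < 1 → f.eval z = g.eval z) :
    f = g := by
  refine Polynomial.eq_of_infinite_eval_eq f g (Infinite.mono (s := ball (0 : ℂ) 1)
    (fun z hz => h z (by simpa using hz)) ?_)
  exact infinite_of_mem_nhds 0 (ball_mem_nhds 0 one_pos)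

/-- If `φ` is a rotation of the first coordinate, then `p` is a unit. -/
theorem IsRIFDenominator.isUnit_of_rif_eq {n : ℕ} {p : MvPolynomial (Fin 2) ℂ}
    (hp : IsRIFDenominator n 1 p) {α τ : Circle}
    (h : ∀ z ∈ bidisk, τ * rif n 1 p z = α * z.1) : IsUnit p := by
  have hS := hp.isStablePair
  set P := sndCoeff n 0 p with hP
  set Q := sndCoeff n 1 p with hQ
  have h1 : ∀ z ∈ bidisk, τ * ((conjReverse n Q).eval z.1 + z.2 * (conjReverse n P).eval z.1)
      = α * z.1 * (P.eval z.1 + z.2 * Q.eval z.1) := by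
    intro z hz
    have e := h z hz
    have hne : pairDen P Q z ≠ 0 := hS.ne_zero z hz
    rw [rif_eq_pairRif hp, pairRif, ← mul_div_assoc, div_eq_iff hne] at e
    exact e
  have e1 : Polynomial.C (τ : ℂ) * conjReverse n Q = Polynomial.C (α : ℂ) * Polynomial.X * P := by
    refine polynomial_eq_of_eval_ball fun z hz => ?_
    simpa using h1 (z, 0) (mem_bidisk.2 ⟨hz, by simp⟩)
  -- The values at z₂ = 0 and z₂ = 1/2 separate the two coefficients in z₂.
  have e2 : Polynomial.C (τ : ℂ) * conjReverse n P = Polynomial.C (α : ℂ) * Polynomial.X * Q := by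
    refine polynomial_eq_of_eval_ball fun z hz => ?_
    have e3 := h1 (z, 1 / 2) (mem_bidisk.2 ⟨hz, by norm_num⟩)
    have e4 := congrArg (Polynomial.eval z) e1
    simp only [Polynomial.eval_mul, Polynomial.eval_C, Polynomial.eval_X] at e3 e4 ⊢
    linear_combination 2 * e3 - 2 * e4
  have e5 : MvPolynomial.C (τ : ℂ) * reflection n 1 p
      = MvPolynomial.C (α : ℂ) * MvPolynomial.X 0 * p := by
    conv_rhs => rw [eq_liftFst_add hp.degree_fst hp.degree_snd]
    rw [reflection_eq hp.degree_fst hp.degree_snd]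
    have hC : ∀ c : ℂ, liftFst (Polynomial.C c) = MvPolynomial.C c := fun c => by
      simp [liftFst, MvPolynomial.algebraMap_eq]
    have hX : liftFst Polynomial.X = MvPolynomial.X 0 := by simp [liftFst]
    have e6 := congrArg liftFst e1
    have e7 := congrArg liftFst e2
    simp only [map_mul, hC, hX] at e6 e7
    linear_combination e6 + MvPolynomial.X 1 * e7
  have hdvd : p ∣ reflection n 1 p := by
    have hu : IsUnit (MvPolynomial.C (τ : ℂ) : MvPolynomial (Fin 2) ℂ) :=
      (isUnit_iff_ne_zero.2 (Circle.coe_ne_zero τ)).map MvPolynomial.C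
    exact hu.dvd_mul_left.1 (e5 ▸ Dvd.intro_left _ rfl)
  exact hp.relPrime hdvd dvd_rfl

theorem pairRif_zero {n : ℕ} {p : MvPolynomial (Fin 2) ℂ} (hp : IsRIFDenominator n 1 p)
    (h0 : evalAt (reflection n 1 p) (0, 0) = 0) :
    pairRif n (sndCoeff n 0 p) (sndCoeff n 1 p) (0, 0) = 0 := by
  rw [← rif_eq_pairRif hp, rif, h0, zero_div]

/-- An extreme σ charging a line is the uniform measure of that line. Its function is that of z₁
alone, so τ₁ φ = α z₁; then p divides p̃ and is a unit, although it has a zero on the torus. -/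
theorem clark_not_mem_extremePoints {n : ℕ} {p : MvPolynomial (Fin 2) ℂ}
    (hp : IsRIFDenominator n 1 p) (h0 : evalAt (reflection n 1 p) (0, 0) = 0) {α : Circle}
    {σ : Measure (Circle × Circle)} (hσ : IsClarkMeasure (rif n 1 p) α σ)
    (hα : IsExceptionalValue n 1 p α) : σ ∉ extremePoints ℝ≥0 pluriharmonicMeasures := by
  intro hext
  obtain ⟨τ, hpτ, hτ⟩ := hα
  have hS := hp.isStablePair
  have hφ0 := pairRif_zero hp h0
  rw [rif_eq_pairRif hp] at hτ hσ
  have hden : pairDen (sndCoeff n 0 p) (sndCoeff n 1 p) (torusPt τ) = 0 := by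
    rw [← hpτ, evalAt_eq hp.degree_fst hp.degree_snd]; rfl
  have hmass := hS.torusLine_mass_pos hφ0 hσ
    (hS.clarkPoly_eq_zero_of_hasNontangentialValue hden hτ)
  have hline := eq_lineMeasure_of_mem_extremePoints hext hmass
  have hf := hS.clarkFunction_mem hφ0 α
  have hu : IsUnit p := by
    refine hp.isUnit_of_rif_eq (α := α) (τ := τ.1) fun z hz => ?_
    have e := eqOn_bidisk_of_re_eq hf.1 (lineFunction_mem τ.1).1
      (hf.2.2.trans (lineFunction_mem τ.1).2.2.symm)
      (fun w hw => by rw [re_lineFunction τ.1 hw, ← hline]; exact hσ.2 w hw) hz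
    rw [clarkFunction, lineFunction, div_eq_div_iff
      (circle_sub_ne_zero (hS.norm_pairRif_lt_one hφ0 hz) α)
      (circle_sub_ne_zero (mem_bidisk.1 hz).1 τ.1)] at e
    rw [rif_eq_pairRif hp]
    linear_combination (1 / 2 : ℂ) * e
  have := hu.map (MvPolynomial.eval ![(torusPt τ).1, (torusPt τ).2])
  rw [show MvPolynomial.eval ![(torusPt τ).1, (torusPt τ).2] p = 0 from hpτ] at this
  simp at this

/-! ### The Clark measure at a generic value -/

/-- The coefficient of `z₂` in `α p - p̃`. -/
def clarkPolySnd (n : ℕ) (P Q : Polynomial ℂ) (α : Circle) : Polynomial ℂ :=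
  Polynomial.C (α : ℂ) * Q - conjReverse n P

/-- The boundary weight `|P|² - |Q|²`. -/
def boundaryWeight (P Q : Polynomial ℂ) (ζ : Circle) : ℝ :=
  ‖P.eval (ζ : ℂ)‖ ^ 2 - ‖Q.eval (ζ : ℂ)‖ ^ 2

theorem continuous_eval_circle (f : Polynomial ℂ) : Continuous fun ζ : Circle => f.eval (ζ : ℂ) :=
  f.continuous.comp continuous_subtype_val

theorem continuous_boundaryWeight (P Q : Polynomial ℂ) : Continuous (boundaryWeight P Q) :=
  ((continuous_eval_circle P).norm.pow 2).sub ((continuous_eval_circle Q).norm.pow 2)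

theorem pairDen_clark (n : ℕ) (P Q : Polynomial ℂ) (α : Circle) (z : ℂ × ℂ) :
    pairDen (clarkPoly n P Q α) (clarkPolySnd n P Q α) z
      = α * pairDen P Q z - pairDen (conjReverse n Q) (conjReverse n P) z := by
  simp [pairDen, clarkPoly, clarkPolySnd]
  ring

theorem pairDen_clark_num (n : ℕ) (P Q : Polynomial ℂ) (α : Circle) (z : ℂ × ℂ) :
    pairDen (Polynomial.C (α : ℂ) * P + conjReverse n Q) (Polynomial.C (α : ℂ) * Q + conjReverse n P) z
      = α * pairDen P Q z + pairDen (conjReverse n Q) (conjReverse n P) z := by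
  simp [pairDen]
  ring

/-- The function whose graph carries the Clark measure. -/
def clarkGraph (n : ℕ) (P Q : Polynomial ℂ) (α : Circle)
    (ha : ∀ ζ : Circle, (clarkPoly n P Q α).eval (ζ : ℂ) ≠ 0) (ζ : Circle) : Circle :=
  (α * ζ ^ n * Circle.ofConjDivSelf _ (ha ζ))⁻¹

/-- The value is -A/B, the root z₂ of α p - p̃ above ζ; it has modulus one because |A| = |B| on the
circle. -/
theorem coe_clarkGraph {n : ℕ} {P Q : Polynomial ℂ} {α : Circle}
    (ha : ∀ ζ : Circle, (clarkPoly n P Q α).eval (ζ : ℂ) ≠ 0) (ζ : Circle) :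
    (clarkGraph n P Q α ha ζ : ℂ) = (clarkPoly n P Q α).eval (ζ : ℂ) /
      (α * (ζ : ℂ) ^ n * conj ((clarkPoly n P Q α).eval (ζ : ℂ))) := by
  have h1 : ((Circle.ofConjDivSelf _ (ha ζ) : Circle) : ℂ)
    = conj ((clarkPoly n P Q α).eval (ζ : ℂ)) / (clarkPoly n P Q α).eval (ζ : ℂ) := rfl
  rw [clarkGraph, Circle.coe_inv, Circle.coe_mul, Circle.coe_mul, Circle.coe_pow, h1]
  have := ha ζ
  field_simp

theorem continuous_clarkGraph {n : ℕ} {P Q : Polynomial ℂ} {α : Circle}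
    (ha : ∀ ζ : Circle, (clarkPoly n P Q α).eval (ζ : ℂ) ≠ 0) :
    Continuous (clarkGraph n P Q α ha) := by
  refine continuous_induced_rng.2 ?_
  have h : Continuous fun ζ : Circle => (clarkPoly n P Q α).eval (ζ : ℂ) /
      (α * (ζ : ℂ) ^ n * conj ((clarkPoly n P Q α).eval (ζ : ℂ))) := by
    have hc := continuous_eval_circle (clarkPoly n P Q α)
    refine hc.div ((continuous_const.mul (continuous_subtype_val.pow n)).mul
      (Complex.continuous_conj.comp hc)) fun ζ => ?_
    have h1 := Circle.coe_ne_zero ζ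
    have h2 := Circle.coe_ne_zero α
    have h3 : conj ((clarkPoly n P Q α).eval (ζ : ℂ)) ≠ 0 := by simpa using ha ζ
    exact mul_ne_zero (mul_ne_zero h2 (pow_ne_zero n h1)) h3
  exact h.congr fun ζ => (coe_clarkGraph ha ζ).symm

/-- The density of the first marginal of the Clark measure. -/
def clarkDensity (n : ℕ) (P Q : Polynomial ℂ) (α : Circle) (ζ : Circle) : ℝ :=
  boundaryWeight P Q ζ / ‖(clarkPoly n P Q α).eval (ζ : ℂ)‖ ^ 2

/-- The first marginal of the Clark measure. -/
def clarkMarginal (n : ℕ) (P Q : Polynomial ℂ) (α : Circle) : Measure Circle :=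
  circleMeasure.withDensity fun ζ => ENNReal.ofReal (clarkDensity n P Q α ζ)

theorem continuous_clarkDensity {n : ℕ} {P Q : Polynomial ℂ} {α : Circle}
    (ha : ∀ ζ : Circle, (clarkPoly n P Q α).eval (ζ : ℂ) ≠ 0) :
    Continuous (clarkDensity n P Q α) :=
  (continuous_boundaryWeight P Q).div ((continuous_eval_circle _).norm.pow 2) fun ζ =>
    pow_ne_zero 2 (norm_ne_zero_iff.2 (ha ζ))

theorem isFiniteMeasure_withDensity_of_continuous {f : Circle → ℝ} (hf : Continuous f)
    {μ : Measure Circle} [IsFiniteMeasure μ] :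
    IsFiniteMeasure (μ.withDensity fun ζ => ENNReal.ofReal (f ζ)) :=
  isFiniteMeasure_withDensity_ofReal (integrable_of_continuous hf).2

theorem integral_withDensity_ofReal {f : Circle → ℝ} (hf : Continuous f) (hf0 : ∀ ζ, 0 ≤ f ζ)
    (μ : Measure Circle) (g : Circle → ℂ) :
    ∫ ζ, g ζ ∂(μ.withDensity fun ζ => ENNReal.ofReal (f ζ)) = ∫ ζ, (f ζ : ℂ) * g ζ ∂μ := by
  rw [integral_withDensity_eq_integral_toReal_smul hf.measurable.ennreal_ofReal
    (.of_forall fun _ => by simp)]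
  refine integral_congr_ae (.of_forall fun ζ => ?_)
  simp [ENNReal.toReal_ofReal (hf0 ζ)]

/-- The map onto the graph carrying the Clark measure. -/
def clarkGraphMap (n : ℕ) (P Q : Polynomial ℂ) (α : Circle)
    (ha : ∀ ζ : Circle, (clarkPoly n P Q α).eval (ζ : ℂ) ≠ 0) (ζ : Circle) : Circle × Circle :=
  (ζ, clarkGraph n P Q α ha ζ)

theorem continuous_clarkGraphMap {n : ℕ} {P Q : Polynomial ℂ} {α : Circle}
    (ha : ∀ ζ : Circle, (clarkPoly n P Q α).eval (ζ : ℂ) ≠ 0) :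
    Continuous (clarkGraphMap n P Q α ha) :=
  continuous_id.prodMk (continuous_clarkGraph ha)

namespace IsStablePair

variable {n : ℕ} {P Q : Polynomial ℂ}

theorem boundaryWeight_nonneg (h : IsStablePair n P Q) (ζ : Circle) : 0 ≤ boundaryWeight P Q ζ := by
  have := h.norm_eval_circle_le ζ
  unfold boundaryWeight
  nlinarith [norm_nonneg (Q.eval (ζ : ℂ))]

theorem clarkDensity_nonneg (h : IsStablePair n P Q) (α ζ : Circle) : 0 ≤ clarkDensity n P Q α ζ :=
  div_nonneg (h.boundaryWeight_nonneg ζ) (by positivity)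

/-- Reflects the fact that α p - p̃ is -α times its own reflection. -/
theorem eval_clarkPolySnd (h : IsStablePair n P Q) (α ζ : Circle) :
    (clarkPolySnd n P Q α).eval (ζ : ℂ)
      = -(α * (ζ : ℂ) ^ n * conj ((clarkPoly n P Q α).eval (ζ : ℂ))) := by
  simp only [clarkPoly, clarkPolySnd, Polynomial.eval_sub, Polynomial.eval_mul, Polynomial.eval_C,
    eval_conjReverse h.degree_fst, eval_conjReverse h.degree_snd, map_sub, map_mul, map_pow,
    Complex.conj_conj]
  have h1 : (α : ℂ) * conj (α : ℂ) = 1 := by rw [Complex.mul_conj, Circle.normSq_coe]; simp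
  have h2 : (ζ : ℂ) ^ n * conj (ζ : ℂ) ^ n = 1 := by
    rw [← mul_pow, Complex.mul_conj, Circle.normSq_coe]; simp
  linear_combination (ζ : ℂ) ^ n * conj (P.eval (ζ : ℂ)) * h1 - α * Q.eval (ζ : ℂ) * h2

theorem pairDen_clark_circle (h : IsStablePair n P Q) {α : Circle}
    (ha : ∀ ζ : Circle, (clarkPoly n P Q α).eval (ζ : ℂ) ≠ 0) (ζ : Circle) (w : ℂ) :
    pairDen (clarkPoly n P Q α) (clarkPolySnd n P Q α) (ζ, w)
      = α * (ζ : ℂ) ^ n * conj ((clarkPoly n P Q α).eval (ζ : ℂ)) * (clarkGraph n P Q α ha ζ - w) := by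
  rw [pairDen, h.eval_clarkPolySnd, coe_clarkGraph]
  have h1 := Circle.coe_ne_zero ζ
  have h2 := Circle.coe_ne_zero α
  have h3 : conj ((clarkPoly n P Q α).eval (ζ : ℂ)) ≠ 0 := by simpa using ha ζ
  field_simp
  ring

/-- On the slice z₁ = ζ, |p|² - |p̃|² is (1 - |w|²) times the boundary weight and |α p - p̃| = |A|
|ψ - w| with ψ the graph function; the quotient is a Poisson kernel in w. -/
theorem re_clark_circle (h : IsStablePair n P Q) {α : Circle}
    (ha : ∀ ζ : Circle, (clarkPoly n P Q α).eval (ζ : ℂ) ≠ 0) (ζ : Circle) (w : ℂ) :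
    (pairDen (Polynomial.C (α : ℂ) * P + conjReverse n Q)
        (Polynomial.C (α : ℂ) * Q + conjReverse n P) (ζ, w) /
      pairDen (clarkPoly n P Q α) (clarkPolySnd n P Q α) (ζ, w)).re
      = clarkDensity n P Q α ζ * diskPoisson w (clarkGraph n P Q α ha ζ) := by
  have hn : ‖pairDen (clarkPoly n P Q α) (clarkPolySnd n P Q α) (ζ, w)‖
      = ‖(clarkPoly n P Q α).eval (ζ : ℂ)‖ * ‖(clarkGraph n P Q α ha ζ : ℂ) - w‖ := by
    rw [h.pairDen_clark_circle ha]
    simp only [norm_mul, norm_pow, Circle.norm_coe, one_pow, one_mul, RCLike.norm_conj]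
  rw [pairDen_clark_num, pairDen_clark, re_herglotz_div, ← pairDen_clark, hn, norm_mul,
    Circle.norm_coe, one_mul, h.norm_sq_pairDen_sub, clarkDensity, diskPoisson, boundaryWeight,
    mul_pow, div_mul_div_comm, mul_comm (1 - ‖w‖ ^ 2)]

/-- The Clark measure at a generic value is carried by a graph. -/
theorem isClarkMeasure_graph (h : IsStablePair n P Q) (h0 : pairRif n P Q (0, 0) = 0) {α : Circle}
    (ha : ∀ ζ : Circle, (clarkPoly n P Q α).eval (ζ : ℂ) ≠ 0) :
    IsClarkMeasure (pairRif n P Q) α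
      ((clarkMarginal n P Q α).map (clarkGraphMap n P Q α ha)) := by
  have hcd := continuous_clarkDensity ha
  have hγ := continuous_clarkGraphMap ha
  have hfin : IsFiniteMeasure (clarkMarginal n P Q α) :=
    isFiniteMeasure_withDensity_of_continuous hcd
  refine ⟨inferInstance, fun z hz => ?_⟩
  obtain ⟨hz1, hz2⟩ := mem_bidisk.1 hz
  have hne : ∀ w ∈ bidisk, pairDen (clarkPoly n P Q α) (clarkPolySnd n P Q α) w ≠ 0 := by
    intro w hw
    have h1 := circle_sub_ne_zero (h.norm_pairRif_lt_one h0 hw) α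
    have h2 : pairDen P Q w ≠ 0 := h.ne_zero w hw
    rw [pairDen_clark, show pairDen (conjReverse n Q) (conjReverse n P) w
      = pairRif n P Q w * pairDen P Q w by rw [pairRif, div_mul_cancel₀ _ h2], ← sub_mul]
    exact mul_ne_zero h1 h2
  have hneT : ∀ ζ : Circle, pairDen (clarkPoly n P Q α) (clarkPolySnd n P Q α) (ζ, z.2) ≠ 0 := by
    intro ζ
    rw [h.pairDen_clark_circle ha]
    have h1 := Circle.coe_ne_zero ζ
    have h2 := Circle.coe_ne_zero α
    have h3 : conj ((clarkPoly n P Q α).eval (ζ : ℂ)) ≠ 0 := by simpa using ha ζ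
    exact mul_ne_zero (mul_ne_zero (mul_ne_zero h2 (pow_ne_zero n h1)) h3)
      (circle_sub_ne_zero hz2 _)
  -- For fixed |z₂| < 1 the function is holomorphic up to |z₁| = 1, since A has no zero there. Hence
  -- Poisson's formula in z₁ yields no singular part.
  have hd := diffContOnCl_of_ne_zero (C := Polynomial.C (α : ℂ) * P + conjReverse n Q)
    (D := Polynomial.C (α : ℂ) * Q + conjReverse n P) hz2 hne hneT
  have hval : (α + pairRif n P Q z) / (α - pairRif n P Q z)
      = pairDen (Polynomial.C (α : ℂ) * P + conjReverse n Q)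
        (Polynomial.C (α : ℂ) * Q + conjReverse n P) z /
      pairDen (clarkPoly n P Q α) (clarkPolySnd n P Q α) z := by
    have h2 : pairDen P Q z ≠ 0 := h.ne_zero z hz
    rw [pairDen_clark_num, pairDen_clark, show pairDen (conjReverse n Q) (conjReverse n P) z
      = pairRif n P Q z * pairDen P Q z by rw [pairRif, div_mul_cancel₀ _ h2], ← sub_mul, ← add_mul,
      mul_div_mul_right _ _ h2]
  have hFc : Continuous fun ζ : Circle => (diskPoisson z.1 ζ : ℂ) *
      (pairDen (Polynomial.C (α : ℂ) * P + conjReverse n Q)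
        (Polynomial.C (α : ℂ) * Q + conjReverse n P) (ζ, z.2) /
      pairDen (clarkPoly n P Q α) (clarkPolySnd n P Q α) (ζ, z.2)) := by
    have hc : ∀ A B : Polynomial ℂ, Continuous fun ζ : Circle => pairDen A B (ζ, z.2) := fun A B =>
      (differentiable_pairDen A B).continuous.comp (by fun_prop)
    exact (Complex.continuous_ofReal.comp (continuous_diskPoisson hz1)).mul
      ((hc _ _).div (hc _ _) hneT)
  have hre := integral_re (𝕜 := ℂ) (integrable_of_continuous (μ := circleMeasure) hFc)
  rw [integral_diskPoisson_mul hd hz1] at hre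
  rw [hval, integral_map hγ.measurable.aemeasurable
    (continuous_poissonKernel₂ hz).aestronglyMeasurable, clarkMarginal,
    integral_withDensity_eq_integral_toReal_smul hcd.measurable.ennreal_ofReal
    (.of_forall fun _ => by simp)]
  simp only [RCLike.re_eq_complex_re] at hre
  rw [← hre]
  refine integral_congr_ae (.of_forall fun ζ => ?_)
  simp only
  rw [Complex.re_ofReal_mul, h.re_clark_circle ha, ENNReal.toReal_ofReal (h.clarkDensity_nonneg α ζ),
    poissonKernel₂_eq_mul, smul_eq_mul]
  simp only [clarkGraphMap]
  ring

end IsStablePair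

/-! ### Extremality at generic values -/

theorem neBot_nhdsNE_circle (τ : Circle) : (𝓝[≠] τ).NeBot := by
  have : ConnectedSpace Circle := Circle.exp_surjective.connectedSpace Circle.exp.continuous
  have : Nontrivial Circle := ⟨⟨1, -1, fun h => by
    have := congrArg (fun z : Circle => (z : ℂ)) h
    norm_num at this⟩⟩
  infer_instance

/-- The bound forces V to vanish at each zero τ of R. After cancelling z - τ the bound holds off τ,
and at τ by continuity since the circle has no isolated point; so multiplicities are handled by
induction. -/
theorem polynomial_dvd_of_norm_le {R V : Polynomial ℂ} (hR : R ≠ 0)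
    (hroots : ∀ z, R.eval z = 0 → ‖z‖ = 1) {C : ℝ}
    (h : ∀ ζ : Circle, ‖V.eval (ζ : ℂ)‖ ≤ C * ‖R.eval (ζ : ℂ)‖) : R ∣ V := by
  induction hN : R.natDegree generalizing R V with
  | zero =>
    rw [Polynomial.eq_C_of_natDegree_eq_zero hN] at hR ⊢
    have hc : R.coeff 0 ≠ 0 := fun hc => hR (by rw [hc, Polynomial.C_0])
    exact ((isUnit_iff_ne_zero.2 hc).map Polynomial.C).dvd
  | succ N ih =>
    obtain ⟨z, hz⟩ := IsAlgClosed.exists_root R (by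
      rw [Polynomial.degree_eq_natDegree hR, hN]; exact_mod_cast Nat.succ_ne_zero N)
    obtain ⟨τ, rfl⟩ := IsStablePair.exists_circle (hroots z hz)
    obtain ⟨R', rfl⟩ := Polynomial.dvd_iff_isRoot.2 hz
    have hVτ : V.eval (τ : ℂ) = 0 := by
      have := h τ
      rw [show Polynomial.eval (τ : ℂ) _ = 0 from hz, norm_zero, mul_zero] at this
      exact norm_le_zero_iff.1 this
    obtain ⟨V', rfl⟩ := Polynomial.dvd_iff_isRoot.2 hVτ
    refine mul_dvd_mul_left _ (ih (right_ne_zero_of_mul hR) (fun w hw => hroots w (by simp [hw])) ?_ ?_)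
    · have hcl : IsClosed {ζ : Circle | ‖V'.eval (ζ : ℂ)‖ ≤ C * ‖R'.eval (ζ : ℂ)‖} :=
        isClosed_le (continuous_eval_circle V').norm
          (continuous_const.mul (continuous_eval_circle R').norm)
      have := neBot_nhdsNE_circle τ
      have hsub : ({τ}ᶜ : Set Circle) ⊆ {ζ : Circle | ‖V'.eval (ζ : ℂ)‖ ≤ C * ‖R'.eval (ζ : ℂ)‖} := by
        intro ζ hζ
        have h1 := h ζ
        simp only [Polynomial.eval_mul, Polynomial.eval_sub, Polynomial.eval_X, Polynomial.eval_C,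
          norm_mul] at h1
        have h2 : 0 < ‖(ζ : ℂ) - τ‖ := norm_pos_iff.2 (sub_ne_zero.2 fun e => hζ (Circle.ext e))
        rw [mul_left_comm] at h1
        exact le_of_mul_le_mul_left h1 h2
      have hall := hcl.closure_subset_iff.2 hsub
      rw [(dense_compl_singleton τ).closure_eq] at hall
      exact fun ζ => hall (mem_univ ζ)
    · rw [Polynomial.natDegree_mul (Polynomial.X_sub_C_ne_zero _) (right_ne_zero_of_mul hR),
        Polynomial.natDegree_X_sub_C] at hN
      omega

theorem exists_eq_C_mul_of_norm_le {R V : Polynomial ℂ} (hR : R ≠ 0)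
    (hroots : ∀ z, R.eval z = 0 → ‖z‖ = 1) (hdeg : V.natDegree ≤ R.natDegree) {C : ℝ}
    (h : ∀ ζ : Circle, ‖V.eval (ζ : ℂ)‖ ≤ C * ‖R.eval (ζ : ℂ)‖) :
    ∃ c : ℂ, V = Polynomial.C c * R := by
  obtain ⟨S, rfl⟩ := polynomial_dvd_of_norm_le hR hroots h
  rcases eq_or_ne S 0 with rfl | hS
  · exact ⟨0, by simp⟩
  · rw [Polynomial.natDegree_mul hR hS] at hdeg
    refine ⟨S.coeff 0, ?_⟩
    rw [← Polynomial.eq_C_of_natDegree_eq_zero (by omega : S.natDegree = 0), mul_comm]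

/-- An almost everywhere inequality of continuous densities holds everywhere, as nonempty open sets
have positive measure. -/
theorem le_of_withDensity_le {f g : Circle → ℝ} (hf : Continuous f) (hg : Continuous g)
    (hg0 : ∀ ζ, 0 ≤ g ζ)
    (h : circleMeasure.withDensity (fun ζ => ENNReal.ofReal (f ζ)) ≤
      circleMeasure.withDensity (fun ζ => ENNReal.ofReal (g ζ))) (ζ : Circle) : f ζ ≤ g ζ := by
  have hae : (fun ζ => ENNReal.ofReal (f ζ)) ≤ᵐ[circleMeasure] fun ζ => ENNReal.ofReal (g ζ) := by
    refine ae_le_of_forall_setLIntegral_le_of_sigmaFinite hf.measurable.ennreal_ofReal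
      fun s hs _ => ?_
    rw [← withDensity_apply _ hs, ← withDensity_apply _ hs]
    exact h s
  by_contra! hlt
  have hopen : IsOpen {ζ | g ζ < f ζ} := isOpen_lt hg hf
  refine hopen.measure_ne_zero circleMeasure ⟨ζ, hlt⟩ ?_
  refine measure_mono_null (fun x hx => ?_) hae
  change ¬ ENNReal.ofReal (f x) ≤ ENNReal.ofReal (g x)
  rw [ENNReal.ofReal_le_ofReal_iff (hg0 x)]
  exact not_le.2 hx

theorem integral_circle_zpow (j : ℤ) :
    ∫ ζ : Circle, ((ζ ^ j : Circle) : ℂ) ∂circleMeasure = if j = 0 then 1 else 0 := by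
  have := integral_diskPoisson_mul_character (r := 0) (by simp) 1 j
  simp only [Complex.ofReal_zero, zero_mul, diskPoisson_zero, Complex.ofReal_one, one_mul,
    one_zpow, Circle.coe_one, mul_one] at this
  rw [this]
  split_ifs with h <;> simp [h]

/-! ### Rigidity of measures with finitely many nonzero moments. -/

/-- A finite measure on the circle whose moments vanish outside `[-n, n]` has a trigonometric
polynomial as density. -/
theorem exists_polynomial_density {π : Measure Circle} [IsFiniteMeasure π] {n : ℕ}
    (h : ∀ l : ℕ, n < l → ∫ ζ : Circle, ((ζ ^ (l : ℤ) : Circle) : ℂ) ∂π = 0) :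
    ∃ (V : Polynomial ℂ) (v : Circle → ℝ), V.natDegree ≤ 2 * n ∧ Continuous v ∧
      (∀ ζ : Circle, V.eval (ζ : ℂ) = (ζ : ℂ) ^ n * v ζ) ∧
      ∀ j : ℤ, ∫ ζ : Circle, (v ζ : ℂ) * ((ζ ^ j : Circle) : ℂ) ∂circleMeasure
        = ∫ ζ : Circle, ((ζ ^ j : Circle) : ℂ) ∂π := by
  let a : ℤ → ℂ := fun j => ∫ ζ : Circle, ((ζ ^ j : Circle) : ℂ) ∂π
  have hconj : ∀ j, conj (a j) = a (-j) := by
    intro j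
    simp only [a]
    rw [← integral_conj]
    simp [← Circle.coe_inv_eq_conj]
  have hzero : ∀ j : ℤ, n < j.natAbs → a j = 0 := by
    intro j hj
    obtain ⟨l, rfl | rfl⟩ := j.eq_nat_or_neg
    · exact h l (by simpa using hj)
    · have h1 := hconj l
      rw [show a l = 0 from h l (by simpa using hj), map_zero] at h1
      exact h1.symm
  -- The density is u = Σ a(-m) ζ^m over |m| ≤ n: integrating against ζ^j picks out m = -j. Then V =
  -- ζ^n u, with m = k - n.
  let V : Polynomial ℂ := ∑ k ∈ Finset.range (2 * n + 1),
    Polynomial.C (a ((n : ℤ) - k)) * Polynomial.X ^ k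
  let u : Circle → ℂ := fun ζ => ∑ k ∈ Finset.range (2 * n + 1),
    a ((n : ℤ) - k) * ((ζ ^ ((k : ℤ) - n) : Circle) : ℂ)
  have hu_real : ∀ ζ, conj (u ζ) = u ζ := by
    intro ζ
    simp only [u, map_sum, map_mul, hconj, ← Circle.coe_inv_eq_conj]
    rw [← Finset.sum_range_reflect]
    refine Finset.sum_congr rfl fun k hk => ?_
    have hk' : k ≤ 2 * n := Nat.lt_succ_iff.1 (Finset.mem_range.1 hk)
    have e : ((2 * n + 1 - 1 - k : ℕ) : ℤ) = 2 * n - k := by omega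
    rw [e, ← zpow_neg]
    congr 2
    · ring
    · congr 1; ring_nf
  have huc : Continuous u := by
    refine continuous_finsetSum _ fun k _ => continuous_const.mul ?_
    have : Continuous fun ζ : Circle => ζ ^ ((k : ℤ) - n) := continuous_zpow _
    exact continuous_subtype_val.comp this
  have hre : ∀ ζ, (((u ζ).re : ℝ) : ℂ) = u ζ := fun ζ => Complex.conj_eq_iff_re.1 (hu_real ζ)
  refine ⟨V, fun ζ => (u ζ).re, ?_, Complex.continuous_re.comp huc, fun ζ => ?_, fun j => ?_⟩
  · exact Polynomial.natDegree_sum_le_of_forall_le _ _ fun k hk =>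
      (Polynomial.natDegree_C_mul_X_pow_le _ _).trans (Nat.lt_succ_iff.1 (Finset.mem_range.1 hk))
  · rw [hre]
    simp only [V, u, Polynomial.eval_finsetSum, Finset.mul_sum]
    refine Finset.sum_congr rfl fun k _ => ?_
    have h1 := Circle.coe_ne_zero ζ
    simp only [Polynomial.eval_mul, Polynomial.eval_C, Polynomial.eval_pow, Polynomial.eval_X,
      Circle.coe_zpow, zpow_sub₀ h1, zpow_natCast]
    field_simp
  · simp only [hre]
    have e : ∀ ζ : Circle, u ζ * ((ζ ^ j : Circle) : ℂ) = ∑ k ∈ Finset.range (2 * n + 1),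
        a ((n : ℤ) - k) * ((ζ ^ ((k : ℤ) - n + j) : Circle) : ℂ) := by
      intro ζ
      simp only [u, Finset.sum_mul, zpow_add, Circle.coe_mul]
      exact Finset.sum_congr rfl fun k _ => by ring
    simp only [e]
    rw [integral_finsetSum _ fun k _ => integrable_of_continuous (by
      have : Continuous fun ζ : Circle => ζ ^ ((k : ℤ) - n + j) := continuous_zpow _
      exact continuous_const.mul (continuous_subtype_val.comp this))]
    simp only [integral_const_mul, integral_circle_zpow]
    by_cases hj : j.natAbs ≤ n
    · rw [Finset.sum_eq_single (((n : ℤ) - j).toNat)]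
      · rw [if_pos (by omega), mul_one, show (n : ℤ) - (((n : ℤ) - j).toNat : ℤ) = j by omega]
      · intro k _ hk
        rw [if_neg (by omega), mul_zero]
      · intro hk
        rw [Finset.mem_range] at hk
        omega
    · rw [show ∫ ζ : Circle, ((ζ ^ j : Circle) : ℂ) ∂π = 0 from hzero j (by omega)]
      refine Finset.sum_eq_zero fun k hk => ?_
      rw [Finset.mem_range] at hk
      rw [if_neg (by omega), mul_zero]

/-- A measure dominated by `w dm` whose moments vanish outside `[-n, n]` is a multiple of `w dm`,
if `ζ ^ n w` is a polynomial of degree `2 n` with all its zeros on the circle. -/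
theorem exists_eq_smul_withDensity {π : Measure Circle} [IsFiniteMeasure π] {n : ℕ}
    (h : ∀ l : ℕ, n < l → ∫ ζ : Circle, ((ζ ^ (l : ℤ) : Circle) : ℂ) ∂π = 0)
    {w : Circle → ℝ} (hw : Continuous w) (hw0 : ∀ ζ, 0 ≤ w ζ) {C : ℝ≥0}
    (hle : π ≤ C • circleMeasure.withDensity fun ζ => ENNReal.ofReal (w ζ))
    {R : Polynomial ℂ} (hR0 : R ≠ 0) (hR : ∀ ζ : Circle, R.eval (ζ : ℂ) = (ζ : ℂ) ^ n * w ζ)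
    (hdeg : R.natDegree = 2 * n) (hroots : ∀ z, R.eval z = 0 → ‖z‖ = 1) :
    ∃ c : ℝ≥0, π = c • circleMeasure.withDensity fun ζ => ENNReal.ofReal (w ζ) := by
  obtain ⟨V, v, hVd, hvc, hV, hmom⟩ := exists_polynomial_density h
  -- The sign of v is not known yet. Adding K times the uniform measure makes v + K a legitimate
  -- density; positivity of π then gives v ≥ 0.
  obtain ⟨K, hK⟩ : ∃ K : ℝ≥0, ∀ ζ, -(K : ℝ) ≤ v ζ := by
    obtain ⟨b, hb⟩ := (isCompact_range hvc).bddBelow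
    refine ⟨(-b).toNNReal, fun ζ => ?_⟩
    have := Real.le_coe_toNNReal (-b)
    have := hb ⟨ζ, rfl⟩
    linarith
  have hvK0 : ∀ ζ, 0 ≤ v ζ + K := fun ζ => by linarith [hK ζ]
  have hvKc : Continuous fun ζ => v ζ + K := hvc.add continuous_const
  have hfin1 : IsFiniteMeasure (circleMeasure.withDensity fun ζ => ENNReal.ofReal (v ζ + K)) :=
    isFiniteMeasure_withDensity_of_continuous hvKc
  have hchar : ∀ (ρ : Measure Circle) [IsFiniteMeasure ρ] (j : ℤ),
      Integrable (fun ζ : Circle => ((ζ ^ j : Circle) : ℂ)) ρ := fun ρ _ j => by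
    have : Continuous fun ζ : Circle => ζ ^ j := continuous_zpow _
    exact integrable_of_continuous (continuous_subtype_val.comp this)
  have hvint : ∀ j : ℤ, Integrable (fun ζ : Circle => (v ζ : ℂ) * ((ζ ^ j : Circle) : ℂ))
      circleMeasure := fun j => by
    have : Continuous fun ζ : Circle => ζ ^ j := continuous_zpow _
    exact integrable_of_continuous ((Complex.continuous_ofReal.comp hvc).mul
      (continuous_subtype_val.comp this))
  have hsum : π + K • circleMeasure
      = circleMeasure.withDensity fun ζ => ENNReal.ofReal (v ζ + K) := by
    refine circle_measure_ext fun j => ?_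
    rw [integral_withDensity_ofReal hvKc hvK0, integral_add_measure (hchar _ j) (hchar _ j),
      integral_smul_nnreal_measure, ← hmom j]
    simp only [Complex.ofReal_add, add_mul]
    rw [integral_add (hvint j) ((hchar _ j).const_mul _), integral_const_mul]
    rfl
  have hKm : circleMeasure.withDensity (fun _ => ENNReal.ofReal (K : ℝ)) = K • circleMeasure := by
    rw [withDensity_const, ENNReal.ofReal_coe_nnreal]; rfl
  have hv0 : ∀ ζ, 0 ≤ v ζ := by
    intro ζ
    have := le_of_withDensity_le continuous_const hvKc hvK0 (by
      rw [hKm, ← hsum]; exact Measure.le_add_left le_rfl) ζ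
    linarith
  have hvw : ∀ ζ, v ζ ≤ C * w ζ := by
    intro ζ
    have := le_of_withDensity_le (g := fun ζ => C * w ζ + K) hvKc (by fun_prop)
      (fun ζ => by have := hw0 ζ; positivity) (by
      have e : (fun ζ => ENNReal.ofReal (C * w ζ + K))
          = (C • fun ζ => ENNReal.ofReal (w ζ)) + fun _ => ENNReal.ofReal (K : ℝ) := by
        funext x
        rw [ENNReal.ofReal_add (mul_nonneg C.coe_nonneg (hw0 x)) K.coe_nonneg,
          ENNReal.ofReal_mul C.coe_nonneg]
        simp [ENNReal.smul_def]
      rw [e, withDensity_add_left (hw.measurable.ennreal_ofReal.const_smul C), hKm, ← hsum]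
      refine add_le_add_left (hle.trans (le_of_eq ?_)) _
      exact (withDensity_smul (C : ENNReal) hw.measurable.ennreal_ofReal).symm) ζ
    linarith
  obtain ⟨c, hc⟩ := exists_eq_C_mul_of_norm_le hR0 hroots (hdeg ▸ hVd) (C := C) (fun ζ => by
    rw [hV, hR, norm_mul, norm_mul, norm_pow, Circle.norm_coe, one_pow, one_mul, one_mul,
      Complex.norm_real, Complex.norm_real, Real.norm_of_nonneg (hv0 ζ),
      Real.norm_of_nonneg (hw0 ζ)]
    exact hvw ζ)
  have hcw : ∀ ζ : Circle, (v ζ : ℂ) = c * w ζ := by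
    intro ζ
    have e := congrArg (Polynomial.eval (ζ : ℂ)) hc
    rw [Polynomial.eval_mul, Polynomial.eval_C, hV, hR, mul_left_comm] at e
    exact mul_left_cancel₀ (pow_ne_zero n (Circle.coe_ne_zero ζ)) e
  -- The constant is a priori complex; since v and w are nonnegative it may be replaced by its
  -- modulus.
  have hvc' : ∀ ζ, v ζ = ‖c‖ * w ζ := by
    intro ζ
    have e := congrArg norm (hcw ζ)
    rwa [norm_mul, Complex.norm_real, Complex.norm_real, Real.norm_of_nonneg (hv0 ζ),
      Real.norm_of_nonneg (hw0 ζ)] at e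
  refine ⟨‖c‖₊, ?_⟩
  have hfin2 : IsFiniteMeasure (circleMeasure.withDensity fun ζ => ENNReal.ofReal (w ζ)) :=
    isFiniteMeasure_withDensity_of_continuous hw
  refine circle_measure_ext fun j => ?_
  rw [integral_smul_nnreal_measure, integral_withDensity_ofReal hw hw0, ← hmom j]
  simp only [hvc', Complex.ofReal_mul, mul_assoc]
  rw [integral_const_mul]
  rfl

theorem withDensity_le_withDensity {X : Type*} [MeasurableSpace X] {μ ν : Measure X} (h : μ ≤ ν)
    (f : X → ENNReal) : μ.withDensity f ≤ ν.withDensity f := by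
  refine Measure.le_intro fun s hs _ => ?_
  rw [withDensity_apply _ hs, withDensity_apply _ hs]
  exact lintegral_mono' (Measure.restrict_mono le_rfl h) le_rfl

/-! ### Measures dominated by a Clark measure. -/

namespace IsStablePair

variable {n : ℕ} {P Q : Polynomial ℂ}

/-- On the circle f f~ = ζ^n |f|². This ties the boundary weight to the polynomial whose zeros
saturation controls. -/
theorem eval_reflectionResultant (h : IsStablePair n P Q) (ζ : Circle) :
    (reflectionResultant n P Q).eval (ζ : ℂ) = (ζ : ℂ) ^ n * boundaryWeight P Q ζ := by
  have e : ∀ w : ℂ, w * conj w = ((‖w‖ ^ 2 : ℝ) : ℂ) := fun w => by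
    rw [Complex.mul_conj, Complex.normSq_eq_norm_sq]
  rw [reflectionResultant, Polynomial.eval_sub, Polynomial.eval_mul, Polynomial.eval_mul,
    eval_conjReverse h.degree_fst, eval_conjReverse h.degree_snd, boundaryWeight, Complex.ofReal_sub,
    ← e, ← e]
  ring

/-- The density of the marginal after multiplication by `|α P - Q̃|²`. -/
def clarkPolyWeight (n : ℕ) (P Q : Polynomial ℂ) (α : Circle) (ζ : Circle) : ℝ :=
  ‖(clarkPoly n P Q α).eval (ζ : ℂ)‖ ^ 2

theorem continuous_clarkPolyWeight (n : ℕ) (P Q : Polynomial ℂ) (α : Circle) :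
    Continuous (clarkPolyWeight n P Q α) := (continuous_eval_circle _).norm.pow 2

/-- Multiplication by |A|² clears the denominator of the density; it loses nothing, as A has no zero
on the circle. -/
theorem withDensity_clarkMarginal (h : IsStablePair n P Q) {α : Circle}
    (ha : ∀ ζ : Circle, (clarkPoly n P Q α).eval (ζ : ℂ) ≠ 0) :
    (clarkMarginal n P Q α).withDensity (fun ζ => ENNReal.ofReal (clarkPolyWeight n P Q α ζ))
      = circleMeasure.withDensity fun ζ => ENNReal.ofReal (boundaryWeight P Q ζ) := by
  rw [clarkMarginal, ← withDensity_mul _ (continuous_clarkDensity ha).measurable.ennreal_ofReal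
    (continuous_clarkPolyWeight n P Q α).measurable.ennreal_ofReal]
  congr 1
  funext ζ
  rw [Pi.mul_apply, ← ENNReal.ofReal_mul (h.clarkDensity_nonneg α ζ), clarkDensity, clarkPolyWeight,
    div_mul_cancel₀ _ (pow_ne_zero 2 (norm_ne_zero_iff.2 (ha ζ)))]

/-- The moments of high order of the weighted marginal of a pluriharmonic measure carried by the
graph vanish. -/
theorem integral_weighted_moment_eq_zero {α : Circle}
    (ha : ∀ ζ : Circle, (clarkPoly n P Q α).eval (ζ : ℂ) ≠ 0)
    {μ : Measure (Circle × Circle)} (hμ : μ ∈ pluriharmonicMeasures)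
    (hgraph : ∀ᵐ ζ ∂μ, ζ = clarkGraphMap n P Q α ha ζ.1) {l : ℕ} (hl : n < l) :
    ∫ ζ, (clarkPolyWeight n P Q α ζ.1 : ℂ) * ((ζ.1 ^ (l : ℤ) : Circle) : ℂ) ∂μ = 0 := by
  obtain ⟨hprob, F, hF, hFμ⟩ := hμ
  set A := clarkPoly n P Q α
  obtain ⟨d, rfl⟩ := Nat.exists_eq_add_of_lt hl
  -- On the graph conj A = A / (α ζ₁^n ζ₂). With l = n + d + 1 the integrand becomes α⁻¹ A² ζ₁^(d+1)
  -- ζ₂⁻¹, a combination of characters with frequencies of opposite signs.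
  have e : ∀ᵐ ζ ∂μ, (clarkPolyWeight n P Q α ζ.1 : ℂ) * ((ζ.1 ^ ((n + d + 1 : ℕ) : ℤ) : Circle) : ℂ)
      = ∑ i ∈ Finset.range ((A ^ 2).natDegree + 1), (α : ℂ)⁻¹ * (A ^ 2).coeff i *
        torusChar ((i + d + 1 : ℕ) : ℤ) (-((1 : ℕ) : ℤ)) ζ := by
    filter_upwards [hgraph] with ζ hζ
    have h2 : (ζ.2 : ℂ) = A.eval (ζ.1 : ℂ) / (α * (ζ.1 : ℂ) ^ n * conj (A.eval (ζ.1 : ℂ))) := by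
      conv_lhs => rw [hζ]
      exact coe_clarkGraph ha ζ.1
    have hA : A.eval (ζ.1 : ℂ) ≠ 0 := ha ζ.1
    have hA' : conj (A.eval (ζ.1 : ℂ)) ≠ 0 := by simpa using hA
    have hα := Circle.coe_ne_zero α
    have h1 := Circle.coe_ne_zero ζ.1
    have hw : (clarkPolyWeight n P Q α ζ.1 : ℂ) = A.eval (ζ.1 : ℂ) * conj (A.eval (ζ.1 : ℂ)) := by
      rw [Complex.mul_conj, Complex.normSq_eq_norm_sq]; rfl
    have hA2 : ∑ i ∈ Finset.range ((A ^ 2).natDegree + 1), (A ^ 2).coeff i * (ζ.1 : ℂ) ^ i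
        = A.eval (ζ.1 : ℂ) ^ 2 := by
      rw [← Polynomial.eval_eq_sum_range, Polynomial.eval_pow]
    have e2 : ∀ i, (α : ℂ)⁻¹ * (A ^ 2).coeff i * torusChar ((i + d + 1 : ℕ) : ℤ) (-((1 : ℕ) : ℤ)) ζ
        = ((A ^ 2).coeff i * (ζ.1 : ℂ) ^ i) * ((α : ℂ)⁻¹ * (ζ.1 : ℂ) ^ (d + 1) * (ζ.2 : ℂ)⁻¹) := by
      intro i
      simp only [torusChar, Circle.coe_mul, zpow_natCast, Circle.coe_pow, zpow_neg, pow_one,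
        Circle.coe_inv]
      ring
    simp only [e2]
    rw [← Finset.sum_mul, hA2, hw, h2, zpow_natCast, Circle.coe_pow]
    field_simp
    ring
  rw [integral_congr_ae e, integral_finsetSum _ fun i _ => integrable_of_continuous (by
    exact continuous_const.mul (continuous_torusChar _ _))]
  refine Finset.sum_eq_zero fun i _ => ?_
  rw [integral_const_mul, integral_torusChar_mixed_eq_zero hF.1 hFμ (Nat.succ_ne_zero _) one_ne_zero,
    mul_zero]

/-- Domination by σ puts μ on the same graph, so μ is determined by its first marginal. After
weighting by |A|² the rigidity of measures on the circle makes that marginal a multiple of the one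
of σ, and equality of total masses fixes the factor. -/
theorem eq_of_le_smul (h : IsStablePair n P Q) (h0 : pairRif n P Q (0, 0) = 0) {α : Circle}
    (ha : ∀ ζ : Circle, (clarkPoly n P Q α).eval (ζ : ℂ) ≠ 0)
    (hdeg : (reflectionResultant n P Q).natDegree = 2 * n)
    (hroots : ∀ z, (reflectionResultant n P Q).eval z = 0 → ‖z‖ = 1)
    {σ μ : Measure (Circle × Circle)} (hσ : IsClarkMeasure (pairRif n P Q) α σ)
    (hμ : μ ∈ pluriharmonicMeasures) {C : ℝ≥0} (hle : μ ≤ C • σ) : μ = σ := by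
  have hprobμ : IsProbabilityMeasure μ := hμ.1
  have hprobσ : IsProbabilityMeasure σ := (h.clark_mem h0 hσ).1
  have hγ := continuous_clarkGraphMap ha
  have hσeq : σ = (clarkMarginal n P Q α).map (clarkGraphMap n P Q α ha) :=
    (h.exists_clark h0 α).unique hσ (h.isClarkMeasure_graph h0 ha)
  have hgraph : ∀ᵐ ζ ∂μ, ζ = clarkGraphMap n P Q α ha ζ.1 := by
    refine (Measure.absolutelyContinuous_of_le_smul (c := (C : ENNReal)) hle).ae_le ?_
    have hms : MeasurableSet {ζ : Circle × Circle | ζ = clarkGraphMap n P Q α ha ζ.1} :=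
      (isClosed_eq continuous_id (hγ.comp continuous_fst)).measurableSet
    rw [hσeq]
    exact (ae_map_iff hγ.measurable.aemeasurable hms).2 (.of_forall fun ζ => rfl)
  set lam := μ.map Prod.fst with hlam
  have hμeq : μ = lam.map (clarkGraphMap n P Q α ha) := by
    rw [hlam, Measure.map_map hγ.measurable measurable_fst]
    conv_lhs => rw [← Measure.map_id (μ := μ)]
    exact Measure.map_congr hgraph
  have hfst : σ.map Prod.fst = clarkMarginal n P Q α := by
    rw [hσeq, Measure.map_map measurable_fst hγ.measurable]
    exact Measure.map_id
  have hlamle : lam ≤ C • clarkMarginal n P Q α := by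
    rw [← hfst, ← Measure.map_smul]
    exact Measure.map_mono hle measurable_fst
  have hcw := continuous_clarkPolyWeight n P Q α
  have hcm : Measurable fun ζ => ENNReal.ofReal (clarkPolyWeight n P Q α ζ) :=
    hcw.measurable.ennreal_ofReal
  have hlamfin : IsFiniteMeasure lam := inferInstance
  have hfin : IsFiniteMeasure (lam.withDensity fun ζ => ENNReal.ofReal (clarkPolyWeight n P Q α ζ)) :=
    isFiniteMeasure_withDensity_of_continuous hcw
  have hR0 : reflectionResultant n P Q ≠ 0 := by
    intro hz
    have := hroots 0 (by rw [hz]; simp)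
    simp at this
  obtain ⟨c, hc⟩ := exists_eq_smul_withDensity (n := n)
    (π := lam.withDensity fun ζ => ENNReal.ofReal (clarkPolyWeight n P Q α ζ))
    (fun l hl => by
      rw [integral_withDensity_ofReal hcw (fun ζ => sq_nonneg _), hlam,
        integral_map measurable_fst.aemeasurable]
      · exact integral_weighted_moment_eq_zero ha hμ hgraph hl
      · have : Continuous fun ζ : Circle => ζ ^ (l : ℤ) := continuous_zpow _
        exact ((Complex.continuous_ofReal.comp hcw).mul
          (continuous_subtype_val.comp this)).aestronglyMeasurable)
    (continuous_boundaryWeight P Q) h.boundaryWeight_nonneg (C := C)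
    (by
      rw [← h.withDensity_clarkMarginal ha]
      refine (withDensity_le_withDensity hlamle _).trans (le_of_eq ?_)
      exact withDensity_smul_measure (C : ENNReal) _)
    hR0 h.eval_reflectionResultant hdeg hroots
  have hlameq : lam = c • clarkMarginal n P Q α := by
    rw [← h.withDensity_clarkMarginal ha] at hc
    have hc' : lam.withDensity (fun ζ => ENNReal.ofReal (clarkPolyWeight n P Q α ζ))
        = (c • clarkMarginal n P Q α).withDensity
          (fun ζ => ENNReal.ofReal (clarkPolyWeight n P Q α ζ)) :=
      hc.trans (withDensity_smul_measure (c : ENNReal) _).symm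
    have hinv : ∀ ρ : Measure Circle, (ρ.withDensity fun ζ =>
        ENNReal.ofReal (clarkPolyWeight n P Q α ζ)).withDensity
        (fun ζ => ENNReal.ofReal (clarkPolyWeight n P Q α ζ))⁻¹ = ρ := fun ρ =>
      withDensity_inv_same hcm (.of_forall fun ζ => by
        have := norm_pos_iff.2 (ha ζ)
        have h1 : 0 < clarkPolyWeight n P Q α ζ := by unfold clarkPolyWeight; positivity
        simpa using h1) (.of_forall fun ζ => ENNReal.ofReal_ne_top)
    rw [← hinv lam, hc', hinv]
  have hμσ : μ = c • σ := by
    rw [hμeq, hlameq, Measure.map_smul, ← hσeq]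
  have hc1 : c = 1 := by
    have := congrArg (fun ρ : Measure (Circle × Circle) => ρ univ) hμσ
    simp only [Measure.smul_apply, measure_univ, ENNReal.smul_def, smul_eq_mul, mul_one] at this
    exact_mod_cast this.symm
  rw [hμσ, hc1, one_smul]

end IsStablePair

theorem le_inv_smul_of_add {s : ℝ≥0} (hs : 0 < s) {μ ν σ : Measure (Circle × Circle)}
    (h : s • μ + ν = σ) : μ ≤ s⁻¹ • σ := by
  have h1 : s • μ ≤ σ := h ▸ Measure.le_add_right le_rfl
  calc μ = s⁻¹ • (s • μ) := by rw [smul_smul, inv_mul_cancel₀ hs.ne', one_smul]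
    _ ≤ s⁻¹ • σ := by
      refine Measure.le_intro fun A _ _ => ?_
      simp only [Measure.smul_apply, ENNReal.smul_def, smul_eq_mul]
      have := h1 A
      simp only [Measure.smul_apply, ENNReal.smul_def, smul_eq_mul] at this
      gcongr

/-- Both members of a convex decomposition of σ are dominated by multiples of σ. Genericity enters
through the absence of zeros of A on the circle: such a zero would produce a zero of p on the torus
with nontangential value α. -/
theorem clark_mem_extremePoints {n : ℕ} {p : MvPolynomial (Fin 2) ℂ}
    (hp : IsRIFDenominator n 1 p) (h0 : evalAt (reflection n 1 p) (0, 0) = 0) {α : Circle}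
    {σ : Measure (Circle × Circle)} (hσ : IsClarkMeasure (rif n 1 p) α σ)
    (hsat : IsTorusSaturated n 1 p) (hdeg : bidegree p = bidegree (reflection n 1 p))
    (hα : IsGenericValue n 1 p α) : σ ∈ extremePoints ℝ≥0 pluriharmonicMeasures := by
  have hS := hp.isStablePair
  have hφ0 := pairRif_zero hp h0
  rw [rif_eq_pairRif hp] at hσ
  obtain ⟨hR, hroots⟩ := hsat.resultant hp hdeg
  have ha : ∀ ζ : Circle, (clarkPoly n (sndCoeff n 0 p) (sndCoeff n 1 p) α).eval (ζ : ℂ) ≠ 0 := by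
    intro τ₁ hτ
    obtain ⟨τ₂, hτ₂⟩ := hS.exists_zero_of_clarkPoly hτ
    refine hα ⟨(τ₁, τ₂), ?_, ?_⟩
    · rw [evalAt_eq hp.degree_fst hp.degree_snd]; exact hτ₂
    · rw [rif_eq_pairRif hp]
      exact hS.hasNontangentialValue (τ := (τ₁, τ₂)) hφ0 hτ
  refine mem_extremePoints.2 ⟨hS.clark_mem hφ0 hσ, fun μ hμ ν hν hseg => ?_⟩
  obtain ⟨s, t, hs, ht, -, hst⟩ := hseg
  exact ⟨hS.eq_of_le_smul hφ0 ha hR hroots hσ hμ (le_inv_smul_of_add hs hst),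
    hS.eq_of_le_smul hφ0 ha hR hroots hσ hν (le_inv_smul_of_add ht (add_comm _ _ |>.trans hst))⟩

end

theorem corollary1p4 (n : ℕ) (p : MvPolynomial (Fin 2) ℂ) (hp : IsRIFDenominator n 1 p)
    (h0 : evalAt (reflection n 1 p) (0, 0) = 0) (α : Circle) :
    (∃! σ : MeasureTheory.Measure (Circle × Circle), IsClarkMeasure (rif n 1 p) α σ) ∧
    ∀ σ : MeasureTheory.Measure (Circle × Circle), IsClarkMeasure (rif n 1 p) α σ →
      (IsExceptionalValue n 1 p α →
        σ ∉ Set.extremePoints ℝ≥0 pluriharmonicMeasures) ∧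
      (IsTorusSaturated n 1 p → bidegree p = bidegree (reflection n 1 p) →
        IsGenericValue n 1 p α →
          σ ∈ Set.extremePoints ℝ≥0 pluriharmonicMeasures) := by
  refine ⟨?_, fun σ hσ => ⟨clark_not_mem_extremePoints hp h0 hσ, clark_mem_extremePoints hp h0 hσ⟩⟩
  rw [rif_eq_pairRif hp]
  exact hp.isStablePair.exists_clark (pairRif_zero hp h0) α
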